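/- Let $\varepsilon\in\{1,-1\}$. Let $\mathbb R^{n+1}_+=\{x_{n+1}>0\}$ carry the metric $x_{n+1}^{-2}\,(dx_1^2+\dots+dx_n^2+\varepsilon\,dx_{n+1}^2)$; for $\varepsilon=1$ this is the upper half-space model of the hyperbolic space $H^{n+1}(-1)$, for $\varepsilon=-1$ that of the de Sitter space $S^{n+1}_1(1)$. It is left-invariant for the Lie group structure with identity $e=(0,\dots,0,1)$ and product $(a\cdot b)_i=a_{n+1}b_i+a_i$ $(i\le n)$, $(a\cdot b)_{n+1}=a_{n+1}b_{n+1}$. Let $M$ be a non-empty smooth $n$-dimensional manifold and $x:M\to\mathbb R^{n+1}_+$ a smooth immersion, space-like if $\varepsilon=-1$, with a smooth normal field $N=\sum_A x_{n+1}\eta_A\,\partial/\partial x_A$ such that $\langle N,N\rangle=\varepsilon$. Let $\mathrm I$ be the induced Riemannian metric on $M$ and $\mathrm{II}$ the second fundamental form, given by $\mathrm{II}(X,Y)=-\varepsilon\langle\nabla_XN,dx(Y)\rangle$ (that is, the component along $N$ of the ambient covariant derivative $\nabla_XY$), and let $H=\frac1n\operatorname{tr}_{\mathrm I}\mathrm{II}$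 be the mean curvature. The normal Gauss map is the left translate $\widetilde N=(L_{x^{-1}})_*N=\sum_A\eta_A\,\partial/\partial x_A(e)$, with values in $T_e\mathbb R^{n+1}_+\cong\mathbb R^{n+1}$, and the fourth fundamental form is $\mathrm{IV}=\langle d\widetilde N,d\widetilde N\rangle$, with the scalar product $\langle a,b\rangle=a_1b_1+\dots+a_nb_n+\varepsilon a_{n+1}b_{n+1}$. **Theorem 3.4.** Suppose that $(M,\mathrm I)$ is Einstein, in the sense that $\mathrm{Ric}=f\,\mathrm I$ for some function $f$ on $M$ (then $f$ is the scalar curvature divided by $n$; it is not required to be constant), that $\mathrm{II}$ is non-degenerate at every point, and that $x$ has no umbilics, i.e. at no point is $\mathrm{II}$ a multiple of $\mathrm I$. If the normal Gauss map is conformal, in the sense that $\mathrm{IV}=\rho\,\mathrm{II}$ for some function $\rho:M\to\mathbb R$, then $n=2$, and on all of $M$ $$\rho=2(H-\eta_3)\ \text{ if }\varepsilon=1,\qquad \rho=2(H+\eta_3)\ \text{ if }\varepsilon=-1.$$ -/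

import Mathlib

open scoped Manifold ContDiff

noncomputable section

/-- The number `∑ g_{ij} v_i w_j`, for a matrix `g` and coordinate vectors `v`, `w`. -/
def matrixForm {m : ℕ} (g : Matrix (Fin m) (Fin m) ℝ) (v w : EuclideanSpace ℝ (Fin m)) : ℝ :=
  ∑ i, ∑ j, g i j * v i * w j

/-- The partial derivative `∂f/∂u_i` at `u`. -/
def partialDeriv {m : ℕ} (i : Fin m) (f : EuclideanSpace ℝ (Fin m) → ℝ)
    (u : EuclideanSpace ℝ (Fin m)) : ℝ :=
  fderiv ℝ f u (EuclideanSpace.single i 1)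

/-- The Christoffel symbol `Γ^k_{ij}` at `u` of the Levi-Civita connection of a
(pseudo-)Riemannian metric `g = (g_{ij})` given in coordinates. -/
def christoffel {m : ℕ} (g : EuclideanSpace ℝ (Fin m) → Matrix (Fin m) (Fin m) ℝ)
    (k i j : Fin m) (u : EuclideanSpace ℝ (Fin m)) : ℝ :=
  (1 / 2) * ∑ l, (g u)⁻¹ k l *
    (partialDeriv i (fun y => g y j l) u + partialDeriv j (fun y => g y i l) u
      - partialDeriv l (fun y => g y i j) u)

/-- The Ricci tensor in coordinates:
`Ric_{jk} = ∂_i Γ^i_{jk} - ∂_j Γ^i_{ik} + Γ^i_{il} Γ^l_{jk} - Γ^i_{jl} Γ^l_{ik}`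
(summed over `i`, `l`). -/
def ricciMatrix {m : ℕ} (g : EuclideanSpace ℝ (Fin m) → Matrix (Fin m) (Fin m) ℝ)
    (u : EuclideanSpace ℝ (Fin m)) : Matrix (Fin m) (Fin m) ℝ :=
  Matrix.of fun j k =>
    ∑ i, (partialDeriv i (christoffel g i j k) u - partialDeriv j (christoffel g i i k) u
      + ∑ l, (christoffel g i i l u * christoffel g l j k u
        - christoffel g i j l u * christoffel g l i k u))

/-- The constant scalar product `a_1 b_1 + ⋯ + a_n b_n + ε a_{n+1} b_{n+1}` on `ℝ^{n+1}`:
the Euclidean one for `ε = 1`, the Lorentz-Minkowski one for `ε = -1`. -/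
def flatMetric (ε : ℝ) (n : ℕ) : Matrix (Fin (n + 1)) (Fin (n + 1)) ℝ :=
  Matrix.diagonal fun A => if A = Fin.last n then ε else 1

/-- The metric `(dx_1² + ⋯ + dx_n² + ε dx_{n+1}²) / x_{n+1}²` on the half-space `x_{n+1} > 0`:
the upper half-space model of `H^{n+1}(-1)` for `ε = 1`, and of the de Sitter space
`S_1^{n+1}(1)` for `ε = -1`. -/
def halfSpaceMetric (ε : ℝ) (n : ℕ) (y : EuclideanSpace ℝ (Fin (n + 1))) :
    Matrix (Fin (n + 1)) (Fin (n + 1)) ℝ :=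
  (y (Fin.last n) ^ 2)⁻¹ • flatMetric ε n

/-- The Lie group multiplication of the half-space: the point `(x_1, …, x_{n+1})` is identified
with the matrix that has diagonal `1, x_{n+1}, …, x_{n+1}, 1` and last column
`log x_{n+1}, x_1, …, x_n, 1`. Thus `(a b)_i = a_{n+1} b_i + a_i` for `i ≤ n` and
`(a b)_{n+1} = a_{n+1} b_{n+1}`. -/
def halfSpaceMul {n : ℕ} (a b : EuclideanSpace ℝ (Fin (n + 1))) : EuclideanSpace ℝ (Fin (n + 1)) :=
  WithLp.toLp 2 fun A =>
    if A = Fin.last n then a (Fin.last n) * b (Fin.last n) else a (Fin.last n) * b A + a A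

/-- The inverse for the Lie group structure `halfSpaceMul`, with identity `(0, …, 0, 1)`. -/
def halfSpaceInv {n : ℕ} (a : EuclideanSpace ℝ (Fin (n + 1))) : EuclideanSpace ℝ (Fin (n + 1)) :=
  WithLp.toLp 2 fun A =>
    if A = Fin.last n then (a (Fin.last n))⁻¹ else -(a (Fin.last n))⁻¹ * a A

/-- An immersed hypersurface of `H^{n+1}` (`ε = 1`), or an immersed space-like hypersurface of
`S_1^{n+1}` (`ε = -1`), in the upper half-space model, with a smooth unit normal field. -/
structure HalfSpaceHypersurface (ε : ℝ) (n : ℕ) (M : Type*) [TopologicalSpace M]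
    [ChartedSpace (EuclideanSpace ℝ (Fin n)) M] where
  /-- the immersion `x`, in the coordinates of the half-space -/
  x : M → EuclideanSpace ℝ (Fin (n + 1))
  /-- the unit normal field `N` along `x`, by its components in the frame `∂/∂x_A` -/
  N : M → EuclideanSpace ℝ (Fin (n + 1))
  contMDiff_x : ContMDiff (𝓡 n) 𝓘(ℝ, EuclideanSpace ℝ (Fin (n + 1))) ∞ x
  contMDiff_N : ContMDiff (𝓡 n) 𝓘(ℝ, EuclideanSpace ℝ (Fin (n + 1))) ∞ N
  x_last_pos : ∀ p, 0 < x p (Fin.last n)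
  /-- The induced symmetric form on each tangent space is positive definite. For `ε = 1` this says
  precisely that `x` is an immersion, for `ε = -1` that `x` is a space-like immersion. -/
  induced_pos : ∀ (p : M) (v : TangentSpace (𝓡 n) p), v ≠ 0 →
    0 < matrixForm (halfSpaceMetric ε n (x p))
      (mfderiv (𝓡 n) 𝓘(ℝ, EuclideanSpace ℝ (Fin (n + 1))) x p v)
      (mfderiv (𝓡 n) 𝓘(ℝ, EuclideanSpace ℝ (Fin (n + 1))) x p v)
  normal : ∀ (p : M) (v : TangentSpace (𝓡 n) p),
    matrixForm (halfSpaceMetric ε n (x p)) (N p)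
      (mfderiv (𝓡 n) 𝓘(ℝ, EuclideanSpace ℝ (Fin (n + 1))) x p v) = 0
  /-- `N` is a unit vector if `ε = 1`, a time-like unit vector if `ε = -1`. -/
  unit : ∀ p : M, matrixForm (halfSpaceMetric ε n (x p)) (N p) (N p) = ε

namespace HalfSpaceHypersurface

variable {ε : ℝ} {n : ℕ} {M : Type*} [TopologicalSpace M]
  [ChartedSpace (EuclideanSpace ℝ (Fin n)) M]

/-- The differential `dx` at `p`. -/
def dx (S : HalfSpaceHypersurface ε n M) (p : M) (v : TangentSpace (𝓡 n) p) :
    EuclideanSpace ℝ (Fin (n + 1)) :=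
  mfderiv (𝓡 n) 𝓘(ℝ, EuclideanSpace ℝ (Fin (n + 1))) S.x p v

/-- The derivative at `p` of the components of `N` with respect to the frame `∂/∂x_A`. -/
def dN (S : HalfSpaceHypersurface ε n M) (p : M) (v : TangentSpace (𝓡 n) p) :
    EuclideanSpace ℝ (Fin (n + 1)) :=
  mfderiv (𝓡 n) 𝓘(ℝ, EuclideanSpace ℝ (Fin (n + 1))) S.N p v

/-- The first fundamental form `I`, the induced metric. -/
def firstForm (S : HalfSpaceHypersurface ε n M) (p : M) (v w : TangentSpace (𝓡 n) p) : ℝ :=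
  matrixForm (halfSpaceMetric ε n (S.x p)) (S.dx p v) (S.dx p w)

/-- The covariant derivative `∇_v N` of `N` along `x`, for the Levi-Civita connection of the
ambient metric. -/
def covDerivNormal (S : HalfSpaceHypersurface ε n M) (p : M) (v : TangentSpace (𝓡 n) p) :
    EuclideanSpace ℝ (Fin (n + 1)) :=
  WithLp.toLp 2 fun A =>
    S.dN p v A + ∑ B, ∑ C, christoffel (halfSpaceMetric ε n) A B C (S.x p) * S.dx p v B * S.N p C

/-- The second fundamental form `II`, i.e. the component along `N` of the ambient covariant
derivative of tangent fields: `∇_v W = (∇_v W)^tangential + II(v, W) N`. As `⟨N, N⟩ = ε` and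
`⟨∇_v W, N⟩ = -⟨W, ∇_v N⟩`, this is `II(v, w) = -ε ⟨∇_v N, dx w⟩`. -/
def secondForm (S : HalfSpaceHypersurface ε n M) (p : M) (v w : TangentSpace (𝓡 n) p) : ℝ :=
  -ε * matrixForm (halfSpaceMetric ε n (S.x p)) (S.covDerivNormal p v) (S.dx p w)

/-- The normal Gauss map: the left translate of `N(p)` to the tangent space at the identity of the
Lie group, that is its image under the differential of `y ↦ x(p)⁻¹ y` at `x(p)`. Its components
in the frame `∂/∂x_A(e)` are the `η_A`. -/
def normalGaussMap (S : HalfSpaceHypersurface ε n M) (p : M) : EuclideanSpace ℝ (Fin (n + 1)) :=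
  fderiv ℝ (fun y => halfSpaceMul (halfSpaceInv (S.x p)) y) (S.x p) (S.N p)

/-- The fourth fundamental form `IV = ⟨dÑ, dÑ⟩`, where `Ñ` is the normal Gauss map and the scalar
product is the Euclidean (`ε = 1`) or the Lorentz-Minkowski one (`ε = -1`). -/
def fourthForm (S : HalfSpaceHypersurface ε n M) (p : M) (v w : TangentSpace (𝓡 n) p) : ℝ :=
  matrixForm (flatMetric ε n)
    (mfderiv (𝓡 n) 𝓘(ℝ, EuclideanSpace ℝ (Fin (n + 1))) S.normalGaussMap p v)
    (mfderiv (𝓡 n) 𝓘(ℝ, EuclideanSpace ℝ (Fin (n + 1))) S.normalGaussMap p w)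

/-- The coefficients `g_{ij} = ⟨∂x/∂u_i, ∂x/∂u_j⟩` of the induced metric in the coordinates `u`
of the preferred chart at `p`. -/
def metricInChart (S : HalfSpaceHypersurface ε n M) (p : M) (u : EuclideanSpace ℝ (Fin n)) :
    Matrix (Fin n) (Fin n) ℝ :=
  Matrix.of fun i j =>
    matrixForm (halfSpaceMetric ε n (S.x ((extChartAt (𝓡 n) p).symm u)))
      (fderiv ℝ (S.x ∘ (extChartAt (𝓡 n) p).symm) u (EuclideanSpace.single i 1))
      (fderiv ℝ (S.x ∘ (extChartAt (𝓡 n) p).symm) u (EuclideanSpace.single j 1))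

/-- The Ricci tensor at `p` of the induced metric, computed in the preferred chart at `p`, by whose
coordinates Mathlib identifies the tangent space at `p` with `ℝ^n`. -/
def ricci (S : HalfSpaceHypersurface ε n M) (p : M) (v w : TangentSpace (𝓡 n) p) : ℝ :=
  matrixForm (ricciMatrix (S.metricInChart p) (extChartAt (𝓡 n) p p)) v w

/-- `M` with the induced metric is Einstein: the Ricci tensor is pointwise a multiple of the metric
(the factor is then the scalar curvature divided by `n`, and is not required to be constant). -/
def IsEinstein (S : HalfSpaceHypersurface ε n M) : Prop :=
  ∀ p : M, ∃ c : ℝ, ∀ v w : TangentSpace (𝓡 n) p, S.ricci p v w = c * S.firstForm p v w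

/-- The second fundamental form is non-degenerate at every point. -/
def NondegenerateSecondForm (S : HalfSpaceHypersurface ε n M) : Prop :=
  ∀ (p : M) (v : TangentSpace (𝓡 n) p),
    (∀ w : TangentSpace (𝓡 n) p, S.secondForm p v w = 0) → v = 0

/-- `p` is an umbilic: `II` is a multiple of `I` at `p`. -/
def IsUmbilic (S : HalfSpaceHypersurface ε n M) (p : M) : Prop :=
  ∃ c : ℝ, ∀ v w : TangentSpace (𝓡 n) p, S.secondForm p v w = c * S.firstForm p v w

/-- The mean curvature `H = (1/n) g^{ij} h_{ij}`, the trace of `II` with respect to `I` over `n`. -/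
def meanCurvature (S : HalfSpaceHypersurface ε n M) (p : M) : ℝ :=
  (1 / n) * Matrix.trace
    ((Matrix.of fun i j : Fin n => S.firstForm p (EuclideanSpace.single i (1 : ℝ) :
        EuclideanSpace ℝ (Fin n)) (EuclideanSpace.single j (1 : ℝ) : EuclideanSpace ℝ (Fin n)))⁻¹ *
      (Matrix.of fun i j : Fin n => S.secondForm p (EuclideanSpace.single i (1 : ℝ) :
        EuclideanSpace ℝ (Fin n)) (EuclideanSpace.single j (1 : ℝ) : EuclideanSpace ℝ (Fin n))))

/-- The normal Gauss map is conformal with factor `ρ`: `IV = ρ II`. -/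
def IsConformalNormalGaussMap (S : HalfSpaceHypersurface ε n M) (ρ : M → ℝ) : Prop :=
  ∀ (p : M) (v w : TangentSpace (𝓡 n) p), S.fourthForm p v w = ρ p * S.secondForm p v w

end HalfSpaceHypersurface

end

/-! The argument is pointwise: each hypothesis becomes a quadratic equation for the shape operator
`S = I⁻¹ II`. Write `η` for the last component of the normal Gauss map. The traced Gauss equation
(`ricciMatrix_eq`) gives `Ric = ε (tr S · II - III) - ε (n - 1) I`, where `III = II I⁻¹ II`, so the
Einstein condition reads `S² - (tr S) S + c = 0` for some number `c`. A comparison of left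
translation with covariant differentiation (`fourthForm_eq`) gives `IV = III - 2 ε η II + η² I`, so
conformality reads `S² - σ S + η² = 0` with `σ = ρ + 2 ε η`. The difference of the two equations
makes `(σ - tr S) S` scalar; as `S` is not scalar, `σ = tr S`. Non-degeneracy forces `η ≠ 0`, for
otherwise `S² = σ S` would give `S = σ`. Hence `S` has exactly the two real eigenvalues `σ/2 ± s`,
where `s² = σ²/4 - η² > 0`. If `r` is the multiplicity of the larger one, `tr S = σ` becomes `σ (2 -
n) = 2 (2r - n) s`. Since `1 ≤ r ≤ n - 1`, the right side is at most `2 |n - 2| s` in absolute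
value, while `|σ| > 2 s`; so `n = 2`. Then `ρ = tr S - 2 ε η` with `tr S = 2 H` is the formula. This
is `dim_eq_two_of_quadratic`, applied in `conformal_at`. For the Gauss equation the half-space is
mapped isometrically into a light cone of a flat space of dimension `n + 3`. The hypersurface
becomes a codimension-three submanifold of a space with constant scalar product, where curvature
follows from commuting partial derivatives (`gauss_equation_flat`), and the curvature of the
half-space appears as the contribution of one extra normal direction. -/

noncomputable section

/-! ### Curvature of metrics induced from a constant scalar product. -/

section FlatGauss

variable {m : ℕ} {V : Type*} [NormedAddCommGroup V] [NormedSpace ℝ V]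

/-- The partial derivative of a vector-valued function. -/
def coordDeriv (i : Fin m) (F : EuclideanSpace ℝ (Fin m) → V) (u : EuclideanSpace ℝ (Fin m)) : V :=
  fderiv ℝ F u (EuclideanSpace.single i 1)

theorem ContDiffAt.coordDeriv {F : EuclideanSpace ℝ (Fin m) → V} {u : EuclideanSpace ℝ (Fin m)}
    (hF : ContDiffAt ℝ ∞ F u) (i : Fin m) : ContDiffAt ℝ ∞ (coordDeriv i F) u :=
  (hF.fderiv_right (m := ∞) (by simp)).clm_apply contDiffAt_const

theorem ContDiffAt.differentiableAt_infty {F : EuclideanSpace ℝ (Fin m) → V}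
    {u : EuclideanSpace ℝ (Fin m)} (hF : ContDiffAt ℝ ∞ F u) : DifferentiableAt ℝ F u :=
  hF.differentiableAt (by simp)

theorem coordDeriv_comm {F : EuclideanSpace ℝ (Fin m) → V} {u : EuclideanSpace ℝ (Fin m)}
    (hF : ContDiffAt ℝ ∞ F u) (i j : Fin m) :
    coordDeriv i (coordDeriv j F) u = coordDeriv j (coordDeriv i F) u := by
  have h1 : DifferentiableAt ℝ (fderiv ℝ F) u :=
    (hF.fderiv_right (m := ∞) (by simp)).differentiableAt (by simp)
  have h2 : IsSymmSndFDerivAt ℝ F u := hF.isSymmSndFDerivAt (by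
    rw [minSmoothness_of_isRCLikeNormedField]; exact WithTop.coe_le_coe.2 le_top)
  have key : ∀ a b : Fin m, coordDeriv a (coordDeriv b F) u
      = fderiv ℝ (fderiv ℝ F) u (EuclideanSpace.single a 1) (EuclideanSpace.single b 1) := by
    intro a b
    unfold coordDeriv
    rw [fderiv_clm_apply h1 (differentiableAt_const _)]
    simp
  rw [key, key, h2.eq]

theorem coordDeriv_congr {F G : EuclideanSpace ℝ (Fin m) → V} {U : Set (EuclideanSpace ℝ (Fin m))}
    (hU : IsOpen U) (h : ∀ u ∈ U, F u = G u) {u : EuclideanSpace ℝ (Fin m)} (hu : u ∈ U)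
    (i : Fin m) : coordDeriv i F u = coordDeriv i G u := by
  unfold coordDeriv
  rw [Filter.EventuallyEq.fderiv_eq (Filter.eventuallyEq_of_mem (hU.mem_nhds hu) h)]

theorem partialDeriv_eq_coordDeriv (i : Fin m) (F : EuclideanSpace ℝ (Fin m) → ℝ) :
    partialDeriv i F = coordDeriv i F := rfl

theorem coordDeriv_bilin (B : V →L[ℝ] V →L[ℝ] ℝ) {F G : EuclideanSpace ℝ (Fin m) → V}
    {u : EuclideanSpace ℝ (Fin m)} (hF : DifferentiableAt ℝ F u) (hG : DifferentiableAt ℝ G u)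
    (i : Fin m) : coordDeriv i (fun y => B (F y) (G y)) u
      = B (coordDeriv i F u) (G u) + B (F u) (coordDeriv i G u) := by
  unfold coordDeriv
  rw [(B.hasFDerivAt_of_bilinear hF.hasFDerivAt hG.hasFDerivAt).fderiv]
  simp [add_comm]

theorem coordDeriv_mul {F G : EuclideanSpace ℝ (Fin m) → ℝ}
    {u : EuclideanSpace ℝ (Fin m)} (hF : DifferentiableAt ℝ F u) (hG : DifferentiableAt ℝ G u)
    (i : Fin m) : coordDeriv i (fun y => F y * G y) u
      = coordDeriv i F u * G u + F u * coordDeriv i G u := by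
  unfold coordDeriv
  rw [fderiv_fun_mul hF hG]
  simp [mul_comm, add_comm]

theorem coordDeriv_sum {ι : Type*} (s : Finset ι) {F : ι → EuclideanSpace ℝ (Fin m) → V}
    {u : EuclideanSpace ℝ (Fin m)} (hF : ∀ a ∈ s, DifferentiableAt ℝ (F a) u)
    (i : Fin m) : coordDeriv i (fun y => ∑ a ∈ s, F a y) u = ∑ a ∈ s, coordDeriv i (F a) u := by
  unfold coordDeriv
  rw [fderiv_fun_sum hF]
  simp

theorem differentiableAt_det {E : Type*} [NormedAddCommGroup E] [NormedSpace ℝ E] {k : ℕ}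
    {g : E → Matrix (Fin k) (Fin k) ℝ} {u : E}
    (hg : ∀ i j, DifferentiableAt ℝ (fun y => g y i j) u) :
    DifferentiableAt ℝ (fun y => (g y).det) u := by
  simp only [Matrix.det_apply']
  refine DifferentiableAt.fun_sum fun σ _ => ?_
  exact (differentiableAt_const _).mul
    (HasFDerivAt.finsetProd fun i _ => (hg _ _).hasFDerivAt).differentiableAt

theorem differentiableAt_matrix_inv {E : Type*} [NormedAddCommGroup E] [NormedSpace ℝ E] {k : ℕ}
    {g : E → Matrix (Fin k) (Fin k) ℝ} {u : E}
    (hg : ∀ i j, DifferentiableAt ℝ (fun y => g y i j) u) (hd : (g u).det ≠ 0) (i j : Fin k) :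
    DifferentiableAt ℝ (fun y => (g y)⁻¹ i j) u := by
  simp only [Matrix.inv_def, Matrix.smul_apply, Ring.inverse_eq_inv', smul_eq_mul,
    Matrix.adjugate_apply]
  refine ((differentiableAt_det hg).inv hd).mul (differentiableAt_det fun a b => ?_)
  by_cases h : a = j
  · subst h; simp
  · simpa [Matrix.updateRow_apply, h] using hg a b

variable {B : V →L[ℝ] V →L[ℝ] ℝ} {X : EuclideanSpace ℝ (Fin m) → V}
  {g : EuclideanSpace ℝ (Fin m) → Matrix (Fin m) (Fin m) ℝ}
  {U : Set (EuclideanSpace ℝ (Fin m))} {u : EuclideanSpace ℝ (Fin m)}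

theorem coordDeriv_metric (hU : IsOpen U) (hX : ∀ u ∈ U, ContDiffAt ℝ ∞ X u)
    (hg : ∀ u ∈ U, ∀ i j, g u i j = B (coordDeriv i X u) (coordDeriv j X u))
    (hu : u ∈ U) (a i j : Fin m) : coordDeriv a (fun y => g y i j) u
      = B (coordDeriv a (coordDeriv i X) u) (coordDeriv j X u)
        + B (coordDeriv i X u) (coordDeriv a (coordDeriv j X) u) := by
  rw [coordDeriv_congr hU (fun v hv => hg v hv i j) hu, coordDeriv_bilin]
  · exact ((hX u hu).coordDeriv i).differentiableAt_infty
  · exact ((hX u hu).coordDeriv j).differentiableAt_infty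

theorem differentiableAt_metric (hU : IsOpen U) (hX : ∀ u ∈ U, ContDiffAt ℝ ∞ X u)
    (hg : ∀ u ∈ U, ∀ i j, g u i j = B (coordDeriv i X u) (coordDeriv j X u))
    (hu : u ∈ U) (i j : Fin m) : DifferentiableAt ℝ (fun y => g y i j) u := by
  have h : (fun y => g y i j) =ᶠ[nhds u] fun y => B (coordDeriv i X y) (coordDeriv j X y) :=
    Filter.eventuallyEq_of_mem (hU.mem_nhds hu) fun v hv => hg v hv i j
  refine DifferentiableAt.congr_of_eventuallyEq ?_ h
  exact (B.hasFDerivAt_of_bilinear ((hX u hu).coordDeriv i).differentiableAt_infty.hasFDerivAt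
    ((hX u hu).coordDeriv j).differentiableAt_infty.hasFDerivAt).differentiableAt

theorem christoffel_of_immersion (hB : ∀ v w, B v w = B w v) (hU : IsOpen U)
    (hX : ∀ u ∈ U, ContDiffAt ℝ ∞ X u)
    (hg : ∀ u ∈ U, ∀ i j, g u i j = B (coordDeriv i X u) (coordDeriv j X u))
    (hu : u ∈ U) (k i j : Fin m) : christoffel g k i j u
      = ∑ l, (g u)⁻¹ k l * B (coordDeriv i (coordDeriv j X) u) (coordDeriv l X u) := by
  unfold christoffel
  rw [Finset.mul_sum]
  refine Finset.sum_congr rfl fun l _ => ?_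
  simp only [partialDeriv_eq_coordDeriv]
  rw [coordDeriv_metric hU hX hg hu, coordDeriv_metric hU hX hg hu,
    coordDeriv_metric hU hX hg hu, coordDeriv_comm (hX u hu) j i, coordDeriv_comm (hX u hu) l i,
    coordDeriv_comm (hX u hu) l j,
    hB (coordDeriv i (coordDeriv l X) u)]
  ring

/-- With the index lowered, Christoffel symbols can be differentiated without a formula for the
derivative of `g⁻¹`. -/
theorem sum_metric_mul_christoffel (hB : ∀ v w, B v w = B w v) (hU : IsOpen U)
    (hX : ∀ u ∈ U, ContDiffAt ℝ ∞ X u)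
    (hg : ∀ u ∈ U, ∀ i j, g u i j = B (coordDeriv i X u) (coordDeriv j X u))
    (hd : ∀ u ∈ U, (g u).det ≠ 0)
    (hu : u ∈ U) (p i j : Fin m) : ∑ k, g u p k * christoffel g k i j u
      = B (coordDeriv i (coordDeriv j X) u) (coordDeriv p X u) := by
  have h := congrFun (congrArg (fun A => Matrix.mulVec A fun l =>
    B (coordDeriv i (coordDeriv j X) u) (coordDeriv l X u))
    (Matrix.mul_nonsing_inv (g u) (isUnit_iff_ne_zero.2 (hd u hu)))) p
  simp only [Matrix.one_mulVec] at h
  rw [← h, ← Matrix.mulVec_mulVec]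
  simp only [christoffel_of_immersion hB hU hX hg hu]
  rfl

theorem differentiableAt_christoffel (hB : ∀ v w, B v w = B w v) (hU : IsOpen U)
    (hX : ∀ u ∈ U, ContDiffAt ℝ ∞ X u)
    (hg : ∀ u ∈ U, ∀ i j, g u i j = B (coordDeriv i X u) (coordDeriv j X u))
    (hd : ∀ u ∈ U, (g u).det ≠ 0)
    (hu : u ∈ U) (k i j : Fin m) : DifferentiableAt ℝ (christoffel g k i j) u := by
  have h : christoffel g k i j =ᶠ[nhds u] fun y =>
      ∑ l, (g y)⁻¹ k l * B (coordDeriv i (coordDeriv j X) y) (coordDeriv l X y) :=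
    Filter.eventuallyEq_of_mem (hU.mem_nhds hu)
      fun v hv => christoffel_of_immersion hB hU hX hg hv k i j
  refine DifferentiableAt.congr_of_eventuallyEq ?_ h
  refine DifferentiableAt.fun_sum fun l _ => ?_
  refine (differentiableAt_matrix_inv (differentiableAt_metric hU hX hg hu) (hd u hu) k l).mul ?_
  exact (B.hasFDerivAt_of_bilinear
    (((hX u hu).coordDeriv j).coordDeriv i).differentiableAt_infty.hasFDerivAt
    ((hX u hu).coordDeriv l).differentiableAt_infty.hasFDerivAt).differentiableAt

/-- The differentiated form of `sum_metric_mul_christoffel`. -/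
theorem sum_metric_mul_coordDeriv_christoffel (hB : ∀ v w, B v w = B w v) (hU : IsOpen U)
    (hX : ∀ u ∈ U, ContDiffAt ℝ ∞ X u)
    (hg : ∀ u ∈ U, ∀ i j, g u i j = B (coordDeriv i X u) (coordDeriv j X u))
    (hd : ∀ u ∈ U, (g u).det ≠ 0)
    (hu : u ∈ U) (p i j k : Fin m) :
    ∑ l, g u p l * (coordDeriv i (christoffel g l j k) u
        + ∑ r, christoffel g l i r u * christoffel g r j k u)
      = B (coordDeriv i (coordDeriv j (coordDeriv k X)) u) (coordDeriv p X u)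
        + B (coordDeriv j (coordDeriv k X) u) (coordDeriv i (coordDeriv p X) u)
        - ∑ l, B (coordDeriv i (coordDeriv p X) u) (coordDeriv l X u) * christoffel g l j k u := by
  have h1 : coordDeriv i (fun y => ∑ l, g y p l * christoffel g l j k y) u
      = B (coordDeriv i (coordDeriv j (coordDeriv k X)) u) (coordDeriv p X u)
        + B (coordDeriv j (coordDeriv k X) u) (coordDeriv i (coordDeriv p X) u) := by
    rw [coordDeriv_congr hU (fun v hv => sum_metric_mul_christoffel hB hU hX hg hd hv p j k) hu,
      coordDeriv_bilin _ (((hX u hu).coordDeriv k).coordDeriv j).differentiableAt_infty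
        ((hX u hu).coordDeriv p).differentiableAt_infty]
  have h2 : coordDeriv i (fun y => ∑ l, g y p l * christoffel g l j k y) u
      = ∑ l, (coordDeriv i (fun y => g y p l) u * christoffel g l j k u
        + g u p l * coordDeriv i (christoffel g l j k) u) := by
    rw [coordDeriv_sum]
    · refine Finset.sum_congr rfl fun l _ => ?_
      exact coordDeriv_mul (differentiableAt_metric hU hX hg hu p l)
        (differentiableAt_christoffel hB hU hX hg hd hu l j k) i
    · exact fun l _ => (differentiableAt_metric hU hX hg hu p l).mul
        (differentiableAt_christoffel hB hU hX hg hd hu l j k)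
  have h3 : ∑ l, g u p l * ∑ r, christoffel g l i r u * christoffel g r j k u
      = ∑ r, B (coordDeriv p X u) (coordDeriv i (coordDeriv r X) u) * christoffel g r j k u := by
    simp only [Finset.mul_sum]
    rw [Finset.sum_comm]
    refine Finset.sum_congr rfl fun r _ => ?_
    rw [hB, ← sum_metric_mul_christoffel hB hU hX hg hd hu p i r, Finset.sum_mul]
    exact Finset.sum_congr rfl fun l _ => by ring
  rw [← h1, h2]
  simp only [mul_add, Finset.sum_add_distrib, h3, coordDeriv_metric hU hX hg hu, add_mul]
  ring

/-- **Gauss equation** for a metric induced from a constant scalar product. -/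
theorem gauss_equation_flat (hB : ∀ v w, B v w = B w v) (hU : IsOpen U)
    (hX : ∀ u ∈ U, ContDiffAt ℝ ∞ X u)
    (hg : ∀ u ∈ U, ∀ i j, g u i j = B (coordDeriv i X u) (coordDeriv j X u))
    (hd : ∀ u ∈ U, (g u).det ≠ 0)
    (hu : u ∈ U) (p i j k : Fin m) :
    ∑ l, g u p l * (partialDeriv i (christoffel g l j k) u - partialDeriv j (christoffel g l i k) u
      + ∑ r, (christoffel g l i r u * christoffel g r j k u
        - christoffel g l j r u * christoffel g r i k u))
      = (B (coordDeriv j (coordDeriv k X) u) (coordDeriv i (coordDeriv p X) u)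
          - ∑ l, B (coordDeriv i (coordDeriv p X) u) (coordDeriv l X u) * christoffel g l j k u)
        - (B (coordDeriv i (coordDeriv k X) u) (coordDeriv j (coordDeriv p X) u)
          - ∑ l, B (coordDeriv j (coordDeriv p X) u) (coordDeriv l X u)
            * christoffel g l i k u) := by
  have h1 := sum_metric_mul_coordDeriv_christoffel hB hU hX hg hd hu p i j k
  have h2 := sum_metric_mul_coordDeriv_christoffel hB hU hX hg hd hu p j i k
  -- Third derivatives of `X` commute, so they cancel when `h2` is subtracted from `h1`.
  rw [coordDeriv_comm ((hX u hu).coordDeriv k) j i] at h2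
  have h3 : ∀ a b c : ℝ, a = b → a - c = b - c := fun a b c h => by rw [h]
  calc _ = (∑ l, g u p l * (coordDeriv i (christoffel g l j k) u
        + ∑ r, christoffel g l i r u * christoffel g r j k u))
        - ∑ l, g u p l * (coordDeriv j (christoffel g l i k) u
        + ∑ r, christoffel g l j r u * christoffel g r i k u) := by
        rw [← Finset.sum_sub_distrib]
        refine Finset.sum_congr rfl fun l _ => ?_
        rw [Finset.sum_sub_distrib, partialDeriv_eq_coordDeriv, partialDeriv_eq_coordDeriv]
        ring
    _ = _ := by rw [h1, h2]; ring

theorem sum_inv_mul_sum_mul {G : Matrix (Fin m) (Fin m) ℝ} (hG : G.det ≠ 0) (v : Fin m → ℝ)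
    (i : Fin m) : ∑ p, G⁻¹ i p * ∑ l, G p l * v l = v i := by
  have h := congrFun (congrArg (fun A => Matrix.mulVec A v)
    (Matrix.nonsing_inv_mul G (isUnit_iff_ne_zero.2 hG))) i
  simp only [Matrix.one_mulVec] at h
  rw [← Matrix.mulVec_mulVec] at h
  exact h

/-- The Ricci tensor of an induced metric, when the normal part of the second derivatives of the
immersion is described by a form `K`. -/
theorem ricciMatrix_of_immersion (hB : ∀ v w, B v w = B w v) (hU : IsOpen U)
    (hX : ∀ u ∈ U, ContDiffAt ℝ ∞ X u)
    (hg : ∀ u ∈ U, ∀ i j, g u i j = B (coordDeriv i X u) (coordDeriv j X u))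
    (hd : ∀ u ∈ U, (g u).det ≠ 0) (hu : u ∈ U) (K : Fin m → Fin m → Fin m → Fin m → ℝ)
    (hK : ∀ a b c d, B (coordDeriv a (coordDeriv b X) u) (coordDeriv c (coordDeriv d X) u)
      = ∑ l, ∑ r, (g u)⁻¹ l r * B (coordDeriv a (coordDeriv b X) u) (coordDeriv r X u)
        * B (coordDeriv c (coordDeriv d X) u) (coordDeriv l X u) + K a b c d)
    (j k : Fin m) :
    ricciMatrix g u j k = ∑ i, ∑ p, (g u)⁻¹ i p * (K j k i p - K i k j p) := by
  simp only [ricciMatrix, Matrix.of_apply]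
  refine Finset.sum_congr rfl fun i _ => ?_
  rw [← sum_inv_mul_sum_mul (hd u hu) (fun l => partialDeriv i (christoffel g l j k) u
    - partialDeriv j (christoffel g l i k) u + ∑ r, (christoffel g l i r u * christoffel g r j k u
        - christoffel g l j r u * christoffel g r i k u)) i]
  refine Finset.sum_congr rfl fun p _ => ?_
  rw [gauss_equation_flat hB hU hX hg hd hu]
  -- The Christoffel sum is the tangential part of the product of second derivatives; only the
  -- normal part `K` survives.
  have key : ∀ a b c d, B (coordDeriv a (coordDeriv b X) u) (coordDeriv c (coordDeriv d X) u)
      - ∑ l, B (coordDeriv c (coordDeriv d X) u) (coordDeriv l X u) * christoffel g l a b u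
      = K a b c d := by
    intro a b c d
    rw [hK, sub_eq_iff_eq_add']
    congr 1
    refine Finset.sum_congr rfl fun l _ => ?_
    rw [christoffel_of_immersion hB hU hX hg hu, Finset.mul_sum]
    exact Finset.sum_congr rfl fun r _ => by ring
  rw [key, key]

end FlatGauss

/-! ### Expansion of a scalar product in an adapted frame. -/

section Expansion

variable {V : Type*} [NormedAddCommGroup V] [NormedSpace ℝ V] [FiniteDimensional ℝ V]

/-- The expansion of a scalar product in a frame that consists of vectors `e_l` with invertible
Gram matrix `g` and orthogonal vectors `ν_a`, of squares `σ_a ≠ 0`, normal to all `e_l`. -/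
theorem bilin_expansion {m s : ℕ} {B : V →L[ℝ] V →L[ℝ] ℝ} (hB : ∀ v w, B v w = B w v)
    (hdim : Module.finrank ℝ V = m + s) {e : Fin m → V} {ν : Fin s → V} {σ : Fin s → ℝ}
    {g : Matrix (Fin m) (Fin m) ℝ} (hg : ∀ i j, g i j = B (e i) (e j)) (hd : g.det ≠ 0)
    (hσ : ∀ a, σ a ≠ 0) (hν : ∀ a b, B (ν a) (ν b) = if a = b then σ a else 0)
    (heν : ∀ i a, B (e i) (ν a) = 0) (v w : V) :
    B v w = ∑ l, ∑ r, g⁻¹ l r * B v (e r) * B w (e l)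
      + ∑ a, (σ a)⁻¹ * B v (ν a) * B w (ν a) := by
  -- Pairing a relation with `ν a` kills the normal coefficients; pairing with `e j` then kills the
  -- others, as the Gram matrix is invertible.
  have hli : LinearIndependent ℝ (Sum.elim e ν) := by
    rw [Fintype.linearIndependent_iff]
    intro c hc
    rw [Fintype.sum_sum_type] at hc
    simp only [Sum.elim_inl, Sum.elim_inr] at hc
    have hright : ∀ a, c (Sum.inr a) = 0 := by
      intro a
      have := congrArg (fun z => B z (ν a)) hc
      simpa [heν, hν, hσ] using this
    have hleft : (fun i => c (Sum.inl i)) = 0 := by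
      apply Matrix.eq_zero_of_vecMul_eq_zero hd
      funext j
      have := congrArg (fun z => B z (e j)) hc
      simp only [hright, zero_smul, Finset.sum_const_zero, add_zero, map_sum, map_smul,
        FunLike.coe_sum, Finset.sum_apply, FunLike.coe_smul, Pi.smul_apply,
        smul_eq_mul, map_zero, zero_apply] at this
      simpa [Matrix.vecMul, dotProduct, hg] using this
    rintro (i | a)
    · exact congrFun hleft i
    · exact hright a
  have hspan : ⊤ ≤ Submodule.span ℝ (Set.range (Sum.elim e ν)) := by
    rw [hli.span_eq_top_of_card_eq_finrank' (by simp [hdim])]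
  let b := Module.Basis.mk hli hspan
  -- `L` is the difference of the two sides as a functional of `w`; it is checked to vanish on the
  -- basis.
  obtain ⟨L, hLw⟩ : ∃ L : V →ₗ[ℝ] ℝ, ∀ w, L w = B v w - (∑ l, ∑ r, g⁻¹ l r * B v (e r) * B (e l) w
      + ∑ a, (σ a)⁻¹ * B v (ν a) * B (ν a) w) :=
    ⟨(B v).toLinearMap - (∑ l, ∑ r, (g⁻¹ l r * B v (e r)) • (B (e l)).toLinearMap
      + ∑ a, ((σ a)⁻¹ * B v (ν a)) • (B (ν a)).toLinearMap), fun w => by simp⟩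
  have hL : L = 0 := by
    refine b.ext fun k => ?_
    rw [Module.Basis.mk_apply]
    rcases k with j | a
    · have h1 : ∑ l, ∑ r, g⁻¹ l r * B v (e r) * B (e l) (e j) = B v (e j) := by
        rw [Finset.sum_comm]
        have h2 : ∀ r, ∑ l, g⁻¹ l r * g l j = if r = j then 1 else 0 := by
          intro r
          have hgt : g.transpose = g := by
            ext i j; rw [Matrix.transpose_apply, hg, hg, hB]
          have h3 := congrFun (congrFun (Matrix.nonsing_inv_mul g (isUnit_iff_ne_zero.2 hd)) r) j
          rw [Matrix.mul_apply, Matrix.one_apply] at h3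
          rw [← h3]
          refine Finset.sum_congr rfl fun l _ => ?_
          have h4 : g⁻¹ l r = g⁻¹ r l := by
            conv_lhs => rw [← hgt, ← Matrix.transpose_nonsing_inv]
            rfl
          rw [h4]
        calc _ = ∑ r, B v (e r) * ∑ l, g⁻¹ l r * g l j := by
              refine Finset.sum_congr rfl fun r _ => ?_
              rw [Finset.mul_sum]
              exact Finset.sum_congr rfl fun l _ => by rw [hg]; ring
          _ = _ := by simp only [h2, mul_ite, mul_one, mul_zero, Finset.sum_ite_eq',
            Finset.mem_univ, if_true]
      rw [hLw, Sum.elim_inl, h1]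
      simp [hB (ν _) (e _), heν]
    · rw [hLw, Sum.elim_inr]
      simp only [heν, hν, mul_zero, Finset.sum_const_zero, zero_add, mul_ite, Finset.sum_ite_eq',
        Finset.mem_univ, if_true, LinearMap.zero_apply]
      field_simp [hσ a]
      ring
  have h0 := LinearMap.congr_fun hL w
  rw [hLw, LinearMap.zero_apply, sub_eq_zero] at h0
  rw [h0]
  simp only [hB w]

end Expansion

/-! ### Linear algebra of the two quadratic equations. -/

section Algebra

open Matrix

/-- A matrix that squares to `s² > 0`, and is not `±s`, has trace `(2 r - n) s` for some
`0 < r < n`. -/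
theorem trace_of_sq_eq_scalar {n : ℕ} {Q : Matrix (Fin n) (Fin n) ℝ} {s : ℝ} (hs : 0 < s)
    (hQ : Q * Q = (s ^ 2) • (1 : Matrix (Fin n) (Fin n) ℝ))
    (h1 : Q ≠ s • (1 : Matrix (Fin n) (Fin n) ℝ)) (h2 : Q ≠ (-s) • (1 : Matrix (Fin n) (Fin n) ℝ)) :
    ∃ r : ℕ, 1 ≤ r ∧ r + 1 ≤ n ∧ Q.trace = (2 * r - n) * s := by
  -- `P` is the projection onto the `s`-eigenspace of `Q` along the `(-s)`-eigenspace. Its rank is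
  -- the required `r`; rank `0` would mean `Q = -s`, full rank `Q = s`.
  set P : Matrix (Fin n) (Fin n) ℝ := (2⁻¹ : ℝ) • (1 + s⁻¹ • Q) with hP
  have hP2 : P * P = P := by
    rw [hP]
    simp only [mul_add, add_mul, mul_one, one_mul, mul_smul_comm,
      smul_mul_assoc, hQ, smul_smul, smul_add]
    rw [show (2⁻¹ * s⁻¹ * (2⁻¹ * s⁻¹ * s ^ 2) : ℝ) = 4⁻¹ by field_simp; norm_num]
    module
  have hQP : Q = s • ((2 : ℝ) • P - 1) := by
    rw [hP, smul_smul]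
    norm_num
    rw [smul_smul, mul_inv_cancel₀ hs.ne', one_smul]
  have hid : IsIdempotentElem (Matrix.toLin' P) := by
    rw [IsIdempotentElem, Module.End.mul_eq_comp, ← Matrix.toLin'_mul, hP2]
  have htr : P.trace = (Module.finrank ℝ (LinearMap.range (Matrix.toLin' P)) : ℝ) := by
    rw [← Matrix.trace_toLin'_eq]
    exact (LinearMap.IsIdempotentElem.isProj_range _ hid).trace
  refine ⟨Module.finrank ℝ (LinearMap.range (Matrix.toLin' P)), ?_, ?_, ?_⟩
  · rw [Nat.one_le_iff_ne_zero]
    intro h0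
    have hz : Matrix.toLin' P = 0 := LinearMap.range_eq_bot.1 (Submodule.finrank_eq_zero.1 h0)
    have hz' : P = 0 := by simpa using hz
    apply h2
    rw [hQP, hz']
    simp
  · have hle := Submodule.finrank_lt (K := ℝ) (s := LinearMap.range (Matrix.toLin' P)) ?_
    · simpa using hle
    · intro ht
      have hsurj := LinearMap.range_eq_top.1 ht
      have hone : P = 1 := by
        apply Matrix.toLin'.injective
        refine LinearMap.ext fun v => ?_
        obtain ⟨w, rfl⟩ := hsurj v
        rw [← LinearMap.comp_apply, ← Matrix.toLin'_mul, hP2]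
        simp
      apply h1
      rw [hQP, hone]
      congr 1
      module
  · rw [hQP, Matrix.trace_smul, Matrix.trace_sub, Matrix.trace_smul, htr, Matrix.trace_one]
    simp
    ring

/-- A self-adjoint, invertible, non-scalar matrix `S = G⁻¹ H` that satisfies both
`S² - σ S + η² = 0` and `S² - (tr S) S + c = 0` exists only in dimension two, and `σ = tr S`. -/
theorem dim_eq_two_of_quadratic {n : ℕ} {G H : Matrix (Fin n) (Fin n) ℝ} (hG : G.PosDef)
    (hH : Hᵀ = H) (hdet : H.det ≠ 0) (hscal : ∀ c : ℝ, H ≠ c • G) {σ η c : ℝ}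
    (hconf : H * G⁻¹ * H = σ • H - (η ^ 2) • G)
    (heins : (G⁻¹ * H).trace • H - H * G⁻¹ * H = c • G) :
    n = 2 ∧ σ = (G⁻¹ * H).trace := by
  have hGu : IsUnit G.det := isUnit_iff_ne_zero.2 hG.det_pos.ne'
  have hGG : G⁻¹ * G = 1 := Matrix.nonsing_inv_mul G hGu
  have hGG' : G * G⁻¹ = 1 := Matrix.mul_nonsing_inv G hGu
  have hGt : Gᵀ = G := by simpa using hG.isHermitian.eq
  set S := G⁻¹ * H with hS
  have hHS : G * S = H := by rw [hS, ← mul_assoc, hGG', one_mul]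
  have hSscal : ∀ a : ℝ, S ≠ a • (1 : Matrix (Fin n) (Fin n) ℝ) := by
    intro a ha
    apply hscal a
    rw [← hHS, ha]; simp
  have hSS : G⁻¹ * (H * G⁻¹ * H) = S * S := by rw [hS]; simp only [mul_assoc]
  have hconf' : S * S = σ • S - (η ^ 2) • (1 : Matrix (Fin n) (Fin n) ℝ) := by
    rw [← hSS, hconf, mul_sub, mul_smul_comm, mul_smul_comm, hGG]
  have heins' : S.trace • S - S * S = c • (1 : Matrix (Fin n) (Fin n) ℝ) := by
    have := congrArg (fun A => G⁻¹ * A) heins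
    simpa only [mul_sub, mul_smul_comm, hGG, hSS] using this
  set T := S.trace with hT
  -- Otherwise the difference of the two quadratic equations exhibits `S` as a scalar.
  have hσ : σ = T := by
    by_contra hne
    apply hSscal ((T - σ)⁻¹ * (c - η ^ 2))
    have hne' : T - σ ≠ 0 := sub_ne_zero.2 (Ne.symm hne)
    rw [mul_smul, eq_inv_smul_iff₀ hne']
    rw [hconf'] at heins'
    rw [sub_smul, sub_smul, ← heins']
    abel
  refine ⟨?_, hσ⟩
  rw [← hσ] at hT
  clear_value T
  subst hσ
  -- If `η = 0`, then `S² = σ S`, and cancelling the invertible `S` makes it scalar.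
  have hη : η ≠ 0 := by
    intro h0
    rw [h0] at hconf'
    have hSu : IsUnit S.det := by
      rw [hS, Matrix.det_mul]
      exact (Matrix.isUnit_nonsing_inv_det G hGu).mul (isUnit_iff_ne_zero.2 hdet)
    apply hSscal σ
    have := congrArg (fun A => A * S⁻¹) hconf'
    simpa [mul_assoc, Matrix.mul_nonsing_inv S hSu] using this
  -- Completing the square makes `Q²` scalar.
  set Q := S - (σ / 2) • (1 : Matrix (Fin n) (Fin n) ℝ) with hQ
  have hQQ : Q * Q = (σ ^ 2 / 4 - η ^ 2) • (1 : Matrix (Fin n) (Fin n) ℝ) := by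
    rw [hQ]
    simp only [mul_sub, sub_mul, mul_smul_comm, smul_mul_assoc, mul_one, one_mul, hconf']
    module
  have hQne : Q ≠ 0 := fun h => hSscal _ (sub_eq_zero.1 h)
  have hGQ : Qᵀ * G = G * Q := by
    have : G * Q = H - (σ / 2) • G := by rw [hQ, mul_sub, hHS]; simp
    calc Qᵀ * G = (G * Q)ᵀ := by rw [Matrix.transpose_mul, hGt]
      _ = G * Q := by rw [this, Matrix.transpose_sub, hH, Matrix.transpose_smul, hGt]
  have hpos : ∀ v : Fin n → ℝ, v ≠ 0 → 0 < v ⬝ᵥ (G *ᵥ v) := fun v hv => by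
    simpa using hG.dotProduct_mulVec_pos hv
  -- `Q` is self-adjoint for `G`, so `G(Qv, Qv)` is the scalar `Q²` times `G(v, v)`. Positivity of
  -- both, for some `v` with `Qv ≠ 0`, gives the sign.
  have hD : 0 < σ ^ 2 / 4 - η ^ 2 := by
    obtain ⟨v, hv⟩ : ∃ v, Q *ᵥ v ≠ 0 := by
      by_contra! h
      apply hQne
      apply Matrix.toLin'.injective
      refine LinearMap.ext fun v => ?_
      simp [h v]
    have hv0 : v ≠ 0 := by rintro rfl; simp at hv
    have h1 := hpos _ hv
    have h2 := hpos _ hv0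
    have h3 : (Q *ᵥ v) ⬝ᵥ (G *ᵥ (Q *ᵥ v)) = (σ ^ 2 / 4 - η ^ 2) * (v ⬝ᵥ (G *ᵥ v)) := by
      rw [Matrix.mulVec_mulVec, ← hGQ, ← Matrix.mulVec_mulVec, Matrix.mulVec_transpose,
        dotProduct_comm, ← Matrix.dotProduct_mulVec, Matrix.mulVec_mulVec, hQQ]
      simp [dotProduct_comm, Matrix.smul_mulVec]
    rw [h3] at h1
    exact (pos_iff_pos_of_mul_pos h1).2 h2
  obtain ⟨r, hr1, hr2, htr⟩ := trace_of_sq_eq_scalar (Real.sqrt_pos.2 hD)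
    (by rw [Real.sq_sqrt hD.le]; exact hQQ)
    (fun h => hSscal (√(σ ^ 2 / 4 - η ^ 2) + σ / 2) (by
      rw [add_smul, ← h, hQ]; abel))
    (fun h => hSscal (-√(σ ^ 2 / 4 - η ^ 2) + σ / 2) (by
      rw [add_smul, ← h, hQ]; abel))
  have htr2 : Q.trace = σ - σ / 2 * n := by
    rw [hQ, Matrix.trace_sub, Matrix.trace_smul, Matrix.trace_one, ← hT]
    simp
  have hsq := Real.sq_sqrt hD.le
  set s := √(σ ^ 2 / 4 - η ^ 2)
  have hr1' : (1 : ℝ) ≤ r := by exact_mod_cast hr1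
  have hr2' : (r : ℝ) + 1 ≤ n := by exact_mod_cast hr2
  have h4 : σ * (2 - n) = 2 * ((2 * r - n) * s) := by rw [← htr, htr2]; ring
  have h5 : σ ^ 2 * (2 - n : ℝ) ^ 2 = 4 * (2 * r - n) ^ 2 * s ^ 2 := by
    rw [← mul_pow, h4]; ring
  -- From `1 ≤ r ≤ n - 1`: the number `2r - n` lies between `2 - n` and `n - 2`.
  have h6 : (2 * r - n : ℝ) ^ 2 ≤ (2 - n) ^ 2 := by nlinarith
  have h7 : σ ^ 2 = 4 * (s ^ 2 + η ^ 2) := by rw [hsq]; ring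
  have h8 : η ^ 2 * (2 - n : ℝ) ^ 2 ≤ 0 := by
    rw [h7] at h5
    nlinarith [mul_le_mul_of_nonneg_right h6 (sq_nonneg s)]
  have h9 : (2 - n : ℝ) ^ 2 ≤ 0 := by
    by_contra! hlt
    exact absurd h8 (not_le.2 (mul_pos (by positivity) hlt))
  have h10 : (2 - n : ℝ) = 0 := pow_eq_zero_iff two_ne_zero |>.1 (le_antisymm h9 (sq_nonneg _))
  have h11 : (n : ℝ) = 2 := by linarith
  exact_mod_cast h11
end Algebra

/-! ### The flat scalar product on the tangent space at the identity. -/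

section FlatForm

/-- The scalar product of `flatMetric`, as a continuous bilinear form. -/
def flatForm (ε : ℝ) (n : ℕ) :
    EuclideanSpace ℝ (Fin (n + 1)) →L[ℝ] EuclideanSpace ℝ (Fin (n + 1)) →L[ℝ] ℝ :=
  ∑ A, flatMetric ε n A A •
    (EuclideanSpace.proj (𝕜 := ℝ) A : EuclideanSpace ℝ (Fin (n + 1)) →L[ℝ] ℝ).smulRight
      (EuclideanSpace.proj A : EuclideanSpace ℝ (Fin (n + 1)) →L[ℝ] ℝ)

variable {ε : ℝ} {n : ℕ}

theorem flatForm_apply (v w : EuclideanSpace ℝ (Fin (n + 1))) :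
    flatForm ε n v w = ∑ A, flatMetric ε n A A * v A * w A := by
  simp [flatForm, mul_assoc]

theorem flatForm_comm (v w : EuclideanSpace ℝ (Fin (n + 1))) :
    flatForm ε n v w = flatForm ε n w v := by
  simp only [flatForm_apply]
  exact Finset.sum_congr rfl fun A _ => by ring

theorem matrixForm_flatMetric (v w : EuclideanSpace ℝ (Fin (n + 1))) :
    matrixForm (flatMetric ε n) v w = flatForm ε n v w := by
  rw [flatForm_apply, matrixForm]
  refine Finset.sum_congr rfl fun A _ => Finset.sum_eq_single A (fun C _ h => ?_) (by simp)
  simp [flatMetric, Matrix.diagonal_apply_ne' _ h]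

theorem matrixForm_halfSpaceMetric (y v w : EuclideanSpace ℝ (Fin (n + 1))) :
    matrixForm (halfSpaceMetric ε n y) v w = (y (Fin.last n) ^ 2)⁻¹ * flatForm ε n v w := by
  rw [← matrixForm_flatMetric]
  simp only [matrixForm, halfSpaceMetric, Matrix.smul_apply, smul_eq_mul, Finset.mul_sum]
  exact Finset.sum_congr rfl fun A _ => Finset.sum_congr rfl fun B _ => by ring

theorem flatForm_single_last (v : EuclideanSpace ℝ (Fin (n + 1))) :
    flatForm ε n v (EuclideanSpace.single (Fin.last n) 1) = ε * v (Fin.last n) := by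
  simp [flatForm_apply, flatMetric]

end FlatForm

/-! ### The half-space as a section of a light cone. -/

section LightCone

variable {ε : ℝ} {n : ℕ}

/-- The scalar product `⟨a, b⟩ - (s t' + t s') / 2` on `ℝ^{n+1} × ℝ × ℝ`. -/
def lightForm (ε : ℝ) (n : ℕ) :
    (EuclideanSpace ℝ (Fin (n + 1)) × ℝ × ℝ) →L[ℝ]
      (EuclideanSpace ℝ (Fin (n + 1)) × ℝ × ℝ) →L[ℝ] ℝ :=
  let V := EuclideanSpace ℝ (Fin (n + 1)) × ℝ × ℝ
  let p : V →L[ℝ] ℝ := (ContinuousLinearMap.fst ℝ ℝ ℝ).comp (ContinuousLinearMap.snd ℝ _ _)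
  let q : V →L[ℝ] ℝ := (ContinuousLinearMap.snd ℝ ℝ ℝ).comp (ContinuousLinearMap.snd ℝ _ _)
  (flatForm ε n).bilinearComp (ContinuousLinearMap.fst ℝ _ _) (ContinuousLinearMap.fst ℝ _ _)
    - (2⁻¹ : ℝ) • (p.smulRight q + q.smulRight p)

theorem lightForm_apply (v w : EuclideanSpace ℝ (Fin (n + 1)) × ℝ × ℝ) :
    lightForm ε n v w
      = flatForm ε n v.1 w.1 - (v.2.1 * w.2.2 + v.2.2 * w.2.1) / 2 := by
  change flatForm ε n v.1 w.1 - 2⁻¹ * (v.2.1 * w.2.2 + v.2.2 * w.2.1) = _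
  ring

theorem lightForm_comm (v w : EuclideanSpace ℝ (Fin (n + 1)) × ℝ × ℝ) :
    lightForm ε n v w = lightForm ε n w v := by
  simp only [lightForm_apply, flatForm_comm v.1]
  ring

/-! ### Differentiation rules for `coordDeriv`. -/

section Calculus

variable {m : ℕ} {V W : Type*} [NormedAddCommGroup V] [NormedSpace ℝ V]
  [NormedAddCommGroup W] [NormedSpace ℝ W] {u : EuclideanSpace ℝ (Fin m)}

theorem coordDeriv_smul {c : EuclideanSpace ℝ (Fin m) → ℝ} {F : EuclideanSpace ℝ (Fin m) → V}
    (hc : DifferentiableAt ℝ c u) (hF : DifferentiableAt ℝ F u) (i : Fin m) :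
    coordDeriv i (fun y => c y • F y) u = coordDeriv i c u • F u + c u • coordDeriv i F u := by
  unfold coordDeriv
  rw [fderiv_fun_smul hc hF]
  simp [add_comm]

theorem coordDeriv_prodMk {F : EuclideanSpace ℝ (Fin m) → V} {G : EuclideanSpace ℝ (Fin m) → W}
    (hF : DifferentiableAt ℝ F u) (hG : DifferentiableAt ℝ G u) (i : Fin m) :
    coordDeriv i (fun y => (F y, G y)) u = (coordDeriv i F u, coordDeriv i G u) := by
  unfold coordDeriv
  rw [hF.fderiv_prodMk hG]
  rfl

theorem coordDeriv_clm (L : V →L[ℝ] W) {F : EuclideanSpace ℝ (Fin m) → V}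
    (hF : DifferentiableAt ℝ F u) (i : Fin m) :
    coordDeriv i (fun y => L (F y)) u = L (coordDeriv i F u) := by
  unfold coordDeriv
  change fderiv ℝ (L ∘ F) u _ = _
  rw [(L.hasFDerivAt.comp u hF.hasFDerivAt).fderiv]
  rfl

theorem coordDeriv_apply {k : ℕ} {F : EuclideanSpace ℝ (Fin m) → EuclideanSpace ℝ (Fin k)}
    (hF : DifferentiableAt ℝ F u) (i : Fin m) (A : Fin k) :
    coordDeriv i (fun y => F y A) u = coordDeriv i F u A :=
  coordDeriv_clm (EuclideanSpace.proj (𝕜 := ℝ) A : EuclideanSpace ℝ (Fin k) →L[ℝ] ℝ) hF i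

theorem coordDeriv_inv {c : EuclideanSpace ℝ (Fin m) → ℝ} (hc : DifferentiableAt ℝ c u)
    (h0 : c u ≠ 0) (i : Fin m) :
    coordDeriv i (fun y => (c y)⁻¹) u = -(c u ^ 2)⁻¹ * coordDeriv i c u := by
  unfold coordDeriv
  change fderiv ℝ ((fun x => x⁻¹) ∘ c) u _ = _
  rw [((hasDerivAt_inv h0).comp_hasFDerivAt u hc.hasFDerivAt).fderiv]
  simp

theorem coordDeriv_const (c : V) (i : Fin m) :
    coordDeriv i (fun _ : EuclideanSpace ℝ (Fin m) => c) u = 0 := by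
  simp [coordDeriv]

theorem coordDeriv_sub {F G : EuclideanSpace ℝ (Fin m) → V}
    (hF : DifferentiableAt ℝ F u) (hG : DifferentiableAt ℝ G u) (i : Fin m) :
    coordDeriv i (fun y => F y - G y) u = coordDeriv i F u - coordDeriv i G u := by
  unfold coordDeriv
  rw [fderiv_fun_sub hF hG]
  rfl

theorem ContDiffAt.bilin (B : V →L[ℝ] V →L[ℝ] ℝ) {F G : EuclideanSpace ℝ (Fin m) → V}
    (hF : ContDiffAt ℝ ∞ F u) (hG : ContDiffAt ℝ ∞ G u) :
    ContDiffAt ℝ ∞ (fun y => B (F y) (G y)) u :=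
  (B.contDiff.contDiffAt.comp u hF).clm_apply hG

end Calculus

/-- A hypersurface of the half-space in coordinates: `f` is the immersion, `ν` are the components of
the unit normal in the left-invariant frame `x_{n+1} ∂/∂x_A`, and `g` is the induced metric. -/
structure LocalHypersurface (ε : ℝ) (n : ℕ)
    (f ν : EuclideanSpace ℝ (Fin n) → EuclideanSpace ℝ (Fin (n + 1)))
    (g : EuclideanSpace ℝ (Fin n) → Matrix (Fin n) (Fin n) ℝ)
    (U : Set (EuclideanSpace ℝ (Fin n))) : Prop where
  isOpen : IsOpen U
  smooth_f : ∀ u ∈ U, ContDiffAt ℝ ∞ f u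
  smooth_ν : ∀ u ∈ U, ContDiffAt ℝ ∞ ν u
  pos : ∀ u ∈ U, 0 < f u (Fin.last n)
  unit : ∀ u ∈ U, flatForm ε n (ν u) (ν u) = ε
  normal : ∀ u ∈ U, ∀ i, flatForm ε n (ν u) (coordDeriv i f u) = 0
  metric : ∀ u ∈ U, ∀ i j,
    g u i j = (f u (Fin.last n) ^ 2)⁻¹ * flatForm ε n (coordDeriv i f u) (coordDeriv j f u)
  det_ne_zero : ∀ u ∈ U, (g u).det ≠ 0

/-- The coefficients of the second fundamental form of a hypersurface of the half-space. -/
def secondFormMatrix (ε : ℝ) {n : ℕ}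
    (f ν : EuclideanSpace ℝ (Fin n) → EuclideanSpace ℝ (Fin (n + 1)))
    (g : EuclideanSpace ℝ (Fin n) → Matrix (Fin n) (Fin n) ℝ) (u : EuclideanSpace ℝ (Fin n)) :
    Matrix (Fin n) (Fin n) ℝ :=
  Matrix.of fun i j => -ε * ((f u (Fin.last n))⁻¹ *
    flatForm ε n (coordDeriv i ν u) (coordDeriv j f u) - ν u (Fin.last n) * g u i j)

/-- The isometric lift of an immersion into the half-space to the light cone. -/
def lightLift (ε : ℝ) {n : ℕ} (f : EuclideanSpace ℝ (Fin n) → EuclideanSpace ℝ (Fin (n + 1)))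
    (u : EuclideanSpace ℝ (Fin n)) : EuclideanSpace ℝ (Fin (n + 1)) × ℝ × ℝ :=
  -- The vector `(y, 1, ⟨y, y⟩)` is null and induces the flat metric. Scaling a null vector by a
  -- function multiplies the induced metric by the square of that function, here `y_{n+1}⁻²`.
  (f u (Fin.last n))⁻¹ • (f u, 1, flatForm ε n (f u) (f u))

/-- The lift of the unit normal field along `lightLift`. -/
def lightNormal (ε : ℝ) {n : ℕ} (f ν : EuclideanSpace ℝ (Fin n) → EuclideanSpace ℝ (Fin (n + 1)))
    (u : EuclideanSpace ℝ (Fin n)) : EuclideanSpace ℝ (Fin (n + 1)) × ℝ × ℝ :=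
  -- This is the differential of `y ↦ y_{n+1}⁻¹ (y, 1, ⟨y, y⟩)` applied to `N = x_{n+1} ν`.
  (ν u, 0, 2 * flatForm ε n (f u) (ν u)) - ν u (Fin.last n) • lightLift ε f u

/-! ### Gauss equation and fourth fundamental form in coordinates. -/

namespace LocalHypersurface

variable {f ν : EuclideanSpace ℝ (Fin n) → EuclideanSpace ℝ (Fin (n + 1))}
  {g : EuclideanSpace ℝ (Fin n) → Matrix (Fin n) (Fin n) ℝ}
  {U : Set (EuclideanSpace ℝ (Fin n))} {u : EuclideanSpace ℝ (Fin n)}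

theorem smooth_last {F : EuclideanSpace ℝ (Fin n) → EuclideanSpace ℝ (Fin (n + 1))}
    (hF : ContDiffAt ℝ ∞ F u) (A : Fin (n + 1)) : ContDiffAt ℝ ∞ (fun y => F y A) u :=
  (EuclideanSpace.proj (𝕜 := ℝ) A :
    EuclideanSpace ℝ (Fin (n + 1)) →L[ℝ] ℝ).contDiff.contDiffAt.comp u hF

theorem smooth_lightLift (h : LocalHypersurface ε n f ν g U) (hu : u ∈ U) :
    ContDiffAt ℝ ∞ (lightLift ε f) u := by
  have hf := h.smooth_f u hu
  exact ((smooth_last hf _).inv (h.pos u hu).ne').smul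
    (hf.prodMk (contDiffAt_const.prodMk (ContDiffAt.bilin _ hf hf)))

theorem coordDeriv_lightLift (h : LocalHypersurface ε n f ν g U) (hu : u ∈ U) (i : Fin n) :
    coordDeriv i (lightLift ε f) u
      = (f u (Fin.last n))⁻¹ • (coordDeriv i f u, 0, 2 * flatForm ε n (f u) (coordDeriv i f u))
        - ((f u (Fin.last n))⁻¹ * coordDeriv i f u (Fin.last n)) • lightLift ε f u := by
  have hf := h.smooth_f u hu
  have hd := hf.differentiableAt_infty
  have hq := ContDiffAt.bilin (flatForm ε n) hf hf
  have ht := smooth_last hf (Fin.last n)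
  have h0 := (h.pos u hu).ne'
  have h1 : coordDeriv i (lightLift ε f) u = coordDeriv i (fun y => (f y (Fin.last n))⁻¹ •
    ((f y, 1, flatForm ε n (f y) (f y)) : EuclideanSpace ℝ (Fin (n + 1)) × ℝ × ℝ)) u := rfl
  rw [h1, coordDeriv_smul (c := fun y => (f y (Fin.last n))⁻¹) (ht.inv h0).differentiableAt_infty
      (hf.prodMk (contDiffAt_const.prodMk hq)).differentiableAt_infty,
    coordDeriv_inv ht.differentiableAt_infty h0, coordDeriv_prodMk hd
      (contDiffAt_const.prodMk hq).differentiableAt_infty,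
    coordDeriv_prodMk (differentiableAt_const _) hq.differentiableAt_infty, coordDeriv_const,
    coordDeriv_bilin _ hd hd, coordDeriv_apply hd, flatForm_comm (coordDeriv i f u), lightLift,
    smul_smul, ← two_mul, sub_eq_add_neg, ← neg_smul]
  refine (add_comm _ _).trans ?_
  congr 2
  field_simp

theorem smooth_lightNormal (h : LocalHypersurface ε n f ν g U) (hu : u ∈ U) :
    ContDiffAt ℝ ∞ (lightNormal ε f ν) u := by
  have hν := h.smooth_ν u hu
  exact (hν.prodMk (contDiffAt_const.prodMk
    (contDiffAt_const.mul (ContDiffAt.bilin _ (h.smooth_f u hu) hν)))).sub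
    ((smooth_last hν _).smul (h.smooth_lightLift hu))

theorem coordDeriv_lightNormal (h : LocalHypersurface ε n f ν g U) (hu : u ∈ U) (i : Fin n) :
    coordDeriv i (lightNormal ε f ν) u
      = (coordDeriv i ν u, 0, 2 * flatForm ε n (f u) (coordDeriv i ν u))
        - (coordDeriv i ν u (Fin.last n) • lightLift ε f u
          + ν u (Fin.last n) • coordDeriv i (lightLift ε f) u) := by
  have hf := h.smooth_f u hu
  have hν := h.smooth_ν u hu
  have hd := hν.differentiableAt_infty
  have hq := ContDiffAt.bilin (flatForm ε n) hf hν
  have hq2 : ContDiffAt ℝ ∞ (fun y => 2 * flatForm ε n (f y) (ν y)) u := contDiffAt_const.mul hq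
  have hX := (h.smooth_lightLift hu)
  have h1 : coordDeriv i (lightNormal ε f ν) u = coordDeriv i (fun y =>
    ((ν y, 0, 2 * flatForm ε n (f y) (ν y)) : EuclideanSpace ℝ (Fin (n + 1)) × ℝ × ℝ)
      - ν y (Fin.last n) • lightLift ε f y) u := rfl
  rw [h1, coordDeriv_sub (hν.prodMk (contDiffAt_const.prodMk hq2)).differentiableAt_infty
      (G := fun y => ν y (Fin.last n) • lightLift ε f y)
      ((smooth_last hν _).smul hX).differentiableAt_infty,
    coordDeriv_smul (smooth_last hν _).differentiableAt_infty hX.differentiableAt_infty,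
    coordDeriv_prodMk hd (contDiffAt_const.prodMk hq2).differentiableAt_infty,
    coordDeriv_prodMk (differentiableAt_const _) hq2.differentiableAt_infty, coordDeriv_const,
    coordDeriv_mul (differentiableAt_const _) hq.differentiableAt_infty, coordDeriv_const,
    coordDeriv_bilin _ hf.differentiableAt_infty hd, coordDeriv_apply hd,
    flatForm_comm (coordDeriv i f u), h.normal u hu]
  simp

theorem lightForm_lift_lift :
    lightForm ε n (lightLift ε f u) (lightLift ε f u) = 0 := by
  simp [lightForm_apply, lightLift]
  ring

theorem lightForm_coordDeriv_lift (h : LocalHypersurface ε n f ν g U) (hu : u ∈ U) (i : Fin n) :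
    lightForm ε n (coordDeriv i (lightLift ε f) u) (lightLift ε f u) = 0 := by
  rw [h.coordDeriv_lightLift hu, map_sub, sub_apply, map_smul, map_smul,
    smul_apply, smul_apply, lightForm_lift_lift]
  simp [lightForm_apply, lightLift, flatForm_comm (coordDeriv i f u)]
  right; ring

theorem metric_eq (h : LocalHypersurface ε n f ν g U) (hu : u ∈ U) (i j : Fin n) :
    g u i j = lightForm ε n (coordDeriv i (lightLift ε f) u) (coordDeriv j (lightLift ε f) u) := by
  conv_rhs => rw [h.coordDeriv_lightLift hu j, map_sub, map_smul, map_smul,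
    h.lightForm_coordDeriv_lift hu, h.coordDeriv_lightLift hu i]
  rw [h.metric u hu]
  simp [lightForm_apply, lightLift, flatForm_comm (f u)]
  ring

/-- The factor `x_{n+1}⁻¹` normalizes the last component to `1`, so the lift stays in an affine
hyperplane; derivatives of the lift are therefore orthogonal to the axis. -/
theorem lightForm_lift_axis (h : LocalHypersurface ε n f ν g U) (hu : u ∈ U) :
    lightForm ε n (lightLift ε f u) (EuclideanSpace.single (Fin.last n) 1, 0, 0) = ε := by
  have h0 := (h.pos u hu).ne'
  rw [lightForm_apply]
  simp only [lightLift, Prod.smul_mk, map_smul, smul_apply, flatForm_single_last, smul_eq_mul]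
  field_simp
  ring

theorem lightForm_normal_lift :
    lightForm ε n (lightNormal ε f ν u) (lightLift ε f u) = 0 := by
  rw [lightNormal, map_sub, sub_apply, map_smul, smul_apply, lightForm_lift_lift]
  simp [lightForm_apply, lightLift, flatForm_comm (f u)]
  ring

theorem lightForm_normal_axis (h : LocalHypersurface ε n f ν g U) (hu : u ∈ U) :
    lightForm ε n (lightNormal ε f ν u) (EuclideanSpace.single (Fin.last n) 1, 0, 0) = 0 := by
  rw [lightNormal, map_sub, sub_apply, map_smul, smul_apply, h.lightForm_lift_axis hu]
  simp only [lightForm_apply, flatForm_single_last, smul_eq_mul]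
  ring

theorem lightForm_normal_normal (h : LocalHypersurface ε n f ν g U) (hu : u ∈ U) :
    lightForm ε n (lightNormal ε f ν u) (lightNormal ε f ν u) = ε := by
  conv_lhs => enter [2]; rw [lightNormal]
  rw [map_sub, map_smul, lightForm_normal_lift, lightNormal, map_sub, sub_apply, map_smul,
    smul_apply]
  simp [lightForm_apply, lightLift, h.unit u hu]
  right; ring

theorem lightForm_coordDeriv_normal (h : LocalHypersurface ε n f ν g U) (hu : u ∈ U) (i : Fin n) :
    lightForm ε n (coordDeriv i (lightLift ε f) u) (lightNormal ε f ν u) = 0 := by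
  rw [h.coordDeriv_lightLift hu, map_sub, sub_apply, map_smul, map_smul,
    smul_apply, smul_apply, lightForm_comm (lightLift ε f u), lightForm_normal_lift, lightNormal,
    map_sub, map_smul]
  simp [lightForm_apply, lightLift, flatForm_comm _ (ν u), h.normal u hu,
    flatForm_comm (coordDeriv i f u) (f u)]
  right; right; ring

theorem lightForm_coordDeriv_coordDeriv_normal (h : LocalHypersurface ε n f ν g U) (hu : u ∈ U)
    (i j : Fin n) :
    lightForm ε n (coordDeriv j (lightLift ε f) u) (coordDeriv i (lightNormal ε f ν) u)
      = (f u (Fin.last n))⁻¹ * flatForm ε n (coordDeriv i ν u) (coordDeriv j f u)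
        - ν u (Fin.last n) * g u i j := by
  have hg : g u i j = g u j i := by rw [h.metric u hu, h.metric u hu, flatForm_comm]
  rw [hg, h.coordDeriv_lightNormal hu, map_sub, map_add, map_smul, map_smul,
    h.lightForm_coordDeriv_lift hu, ← h.metric_eq hu, h.coordDeriv_lightLift hu, map_sub, sub_apply,
    map_smul, map_smul, smul_apply, smul_apply]
  simp [lightForm_apply, lightLift, flatForm_comm (coordDeriv j f u)]
  right; ring

/-- Obtained by differentiating the orthogonality of `∂_j X` and the lifted normal. -/
theorem lightForm_coordDeriv₂_normal (h : LocalHypersurface ε n f ν g U) (hε : ε * ε = 1)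
    (hu : u ∈ U) (i j : Fin n) :
    lightForm ε n (coordDeriv i (coordDeriv j (lightLift ε f)) u) (lightNormal ε f ν u)
      = ε * secondFormMatrix ε f ν g u i j := by
  have h1 := coordDeriv_congr h.isOpen (fun v hv => h.lightForm_coordDeriv_normal hv j) hu i
  rw [coordDeriv_bilin _ ((h.smooth_lightLift hu).coordDeriv j).differentiableAt_infty
    (h.smooth_lightNormal hu).differentiableAt_infty, coordDeriv_const,
    h.lightForm_coordDeriv_coordDeriv_normal hu] at h1
  rw [eq_neg_of_add_eq_zero_left h1, secondFormMatrix, Matrix.of_apply, ← mul_assoc, mul_neg, hε]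
  ring

/-- Obtained by differentiating `⟨∂_j X, X⟩ = 0`. This component is the source of the constant
curvature term in the Gauss equation. -/
theorem lightForm_coordDeriv₂_lift (h : LocalHypersurface ε n f ν g U) (hu : u ∈ U)
    (i j : Fin n) :
    lightForm ε n (coordDeriv i (coordDeriv j (lightLift ε f)) u) (lightLift ε f u)
      = - g u j i := by
  have h1 := coordDeriv_congr h.isOpen (fun v hv => h.lightForm_coordDeriv_lift hv j) hu i
  rw [coordDeriv_bilin _ ((h.smooth_lightLift hu).coordDeriv j).differentiableAt_infty
    (h.smooth_lightLift hu).differentiableAt_infty, coordDeriv_const,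
    ← h.metric_eq hu] at h1
  exact eq_neg_of_add_eq_zero_left h1

theorem lightForm_coordDeriv_axis (h : LocalHypersurface ε n f ν g U) (hu : u ∈ U) (i : Fin n) :
    lightForm ε n (coordDeriv i (lightLift ε f) u)
      (EuclideanSpace.single (Fin.last n) 1, 0, 0) = 0 := by
  have h1 := coordDeriv_congr h.isOpen (fun v hv => h.lightForm_lift_axis hv) hu i
  rw [coordDeriv_bilin _ (h.smooth_lightLift hu).differentiableAt_infty (differentiableAt_const _),
    coordDeriv_const, coordDeriv_const, map_zero, add_zero] at h1
  exact h1

theorem lightForm_coordDeriv₂_axis (h : LocalHypersurface ε n f ν g U) (hu : u ∈ U)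
    (i j : Fin n) :
    lightForm ε n (coordDeriv i (coordDeriv j (lightLift ε f)) u)
      (EuclideanSpace.single (Fin.last n) 1, 0, 0) = 0 := by
  have h1 := coordDeriv_congr h.isOpen (fun v hv => h.lightForm_coordDeriv_axis hv j) hu i
  rw [coordDeriv_bilin _ ((h.smooth_lightLift hu).coordDeriv j).differentiableAt_infty
    (differentiableAt_const _), coordDeriv_const, coordDeriv_const, map_zero, add_zero] at h1
  exact h1

/-- Symmetry is inherited from the second derivatives of the lift. -/
theorem secondFormMatrix_symm (h : LocalHypersurface ε n f ν g U) (hε : ε * ε = 1)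
    (hu : u ∈ U) (i j : Fin n) :
    secondFormMatrix ε f ν g u i j = secondFormMatrix ε f ν g u j i := by
  have h1 := h.lightForm_coordDeriv₂_normal hε hu i j
  rw [coordDeriv_comm (h.smooth_lightLift hu), h.lightForm_coordDeriv₂_normal hε hu] at h1
  have hε0 : ε ≠ 0 := by rintro rfl; simp at hε
  exact (mul_left_cancel₀ hε0 h1).symm

theorem metric_symm (h : LocalHypersurface ε n f ν g U) (hu : u ∈ U) (i j : Fin n) :
    g u i j = g u j i := by
  rw [h.metric u hu, h.metric u hu, flatForm_comm]

theorem metric_inv_symm (h : LocalHypersurface ε n f ν g U) (hu : u ∈ U) (i j : Fin n) :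
    (g u)⁻¹ i j = (g u)⁻¹ j i := by
  have h1 : (g u).transpose = g u := by
    ext i j
    exact h.metric_symm hu j i
  conv_lhs => rw [← h1, ← Matrix.transpose_nonsing_inv]
  rfl

theorem lightForm_coordDeriv₂ (h : LocalHypersurface ε n f ν g U) (hε : ε * ε = 1)
    (hu : u ∈ U) (a b c d : Fin n) :
    lightForm ε n (coordDeriv a (coordDeriv b (lightLift ε f)) u)
        (coordDeriv c (coordDeriv d (lightLift ε f)) u)
      = ∑ l, ∑ r, (g u)⁻¹ l r
          * lightForm ε n (coordDeriv a (coordDeriv b (lightLift ε f)) u)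
            (coordDeriv r (lightLift ε f) u)
          * lightForm ε n (coordDeriv c (coordDeriv d (lightLift ε f)) u)
            (coordDeriv l (lightLift ε f) u)
        + ε * (secondFormMatrix ε f ν g u a b * secondFormMatrix ε f ν g u c d
          - g u a b * g u c d) := by
  have hε0 : ε ≠ 0 := by rintro rfl; simp at hε
  have hεi : ε⁻¹ = ε := inv_eq_of_mul_eq_one_left hε
  set E : EuclideanSpace ℝ (Fin (n + 1)) × ℝ × ℝ := (EuclideanSpace.single (Fin.last n) 1, 0, 0)
    with hE
  have hEE : lightForm ε n E E = ε := by
    simp [hE, lightForm_apply, flatForm_single_last]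
  have hNX := lightForm_normal_lift (ε := ε) (f := f) (ν := ν) (u := u)
  have hXX := lightForm_lift_lift (ε := ε) (f := f) (u := u)
  have hXE := h.lightForm_lift_axis hu
  have hNE := h.lightForm_normal_axis hu
  have hNN := h.lightForm_normal_normal hu
  rw [← hE] at hXE hNE
  have hEX := (lightForm_comm E (lightLift ε f u)).trans hXE
  have hEN := (lightForm_comm E (lightNormal ε f ν u)).trans hNE
  have hXN := (lightForm_comm (lightLift ε f u) (lightNormal ε f ν u)).trans hNX
  rw [bilin_expansion (s := 3) lightForm_comm (by simp)
    (e := fun i => coordDeriv i (lightLift ε f) u)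
    -- Since `⟨X, X⟩ = 0` and `⟨X, E⟩ = ⟨E, E⟩ = ε`, the vectors `X - E` and `E` are orthogonal with
    -- squares `-ε` and `ε`. Second derivatives of `X` have components `-g` along `X - E` and `0`
    -- along `E`.
    (ν := ![lightNormal ε f ν u, lightLift ε f u - E, E]) (σ := ![ε, -ε, ε]) (g := g u)
    (h.metric_eq hu) (h.det_ne_zero u hu)]
  · congr 1
    rw [Fin.sum_univ_three]
    simp only [Matrix.cons_val,
      map_sub, hE, h.lightForm_coordDeriv₂_normal hε hu, h.lightForm_coordDeriv₂_lift hu,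
      h.lightForm_coordDeriv₂_axis hu, h.metric_symm hu b a, h.metric_symm hu d c, inv_neg, hεi]
    linear_combination (secondFormMatrix ε f ν g u a b * secondFormMatrix ε f ν g u c d * ε) * hε
  · intro a
    fin_cases a <;> simp [hε0]
  · intro a b
    fin_cases a <;> fin_cases b <;>
      simp [hNX, hXX, hXE, hNE, hNN, hEX, hEN, hXN, hEE]
  · intro i a
    have h1 := h.lightForm_coordDeriv_axis hu i
    rw [← hE] at h1
    fin_cases a <;> simp [h.lightForm_coordDeriv_normal hu, h.lightForm_coordDeriv_lift hu, h1]

/-- The **Gauss equation**, traced, for a hypersurface of the half-space. -/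
theorem ricciMatrix_eq (h : LocalHypersurface ε n f ν g U) (hε : ε * ε = 1) (hu : u ∈ U) :
    ricciMatrix g u = ε • (((g u)⁻¹ * secondFormMatrix ε f ν g u).trace •
        secondFormMatrix ε f ν g u
      - secondFormMatrix ε f ν g u * (g u)⁻¹ * secondFormMatrix ε f ν g u)
      - (ε * (n - 1)) • g u := by
  ext j k
  rw [ricciMatrix_of_immersion lightForm_comm h.isOpen (fun v hv => h.smooth_lightLift hv)
    (fun v hv => h.metric_eq hv) h.det_ne_zero hu (fun a b c d => ε *
      (secondFormMatrix ε f ν g u a b * secondFormMatrix ε f ν g u c d - g u a b * g u c d))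
    (fun a b c d => h.lightForm_coordDeriv₂ hε hu a b c d)]
  set A := secondFormMatrix ε f ν g u
  have hA : ∀ i j, A i j = A j i := h.secondFormMatrix_symm hε hu
  have hG : (g u)⁻¹ * g u = 1 :=
    Matrix.nonsing_inv_mul _ (isUnit_iff_ne_zero.2 (h.det_ne_zero u hu))
  have hgs := h.metric_symm hu
  have t1 : ((g u)⁻¹ * A).trace = ∑ i, ∑ p, (g u)⁻¹ i p * A i p := by
    simp only [Matrix.trace, Matrix.diag, Matrix.mul_apply]
    exact Finset.sum_congr rfl fun i _ => Finset.sum_congr rfl fun p _ => by rw [hA i p]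
  have hmul : ∀ P : Matrix (Fin n) (Fin n) ℝ,
      (P * (g u)⁻¹ * P) j k = ∑ i, ∑ p, (g u)⁻¹ i p * (P i k * P j p) := by
    intro P
    simp only [Matrix.mul_apply, Finset.sum_mul]
    exact Finset.sum_congr rfl fun i _ => Finset.sum_congr rfl fun p _ => by
      rw [h.metric_inv_symm hu i p]; ring
  have t3 : (n : ℝ) = ∑ i, ∑ p, (g u)⁻¹ i p * g u i p := by
    have h1 := congrArg Matrix.trace hG
    rw [Matrix.trace_one, Fintype.card_fin] at h1
    rw [← h1]
    simp only [Matrix.trace, Matrix.diag, Matrix.mul_apply]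
    exact Finset.sum_congr rfl fun i _ => Finset.sum_congr rfl fun p _ => by rw [hgs]
  -- Writing `g` as `g g⁻¹ g` puts every term in the form of a double sum against `g⁻¹`, for a
  -- termwise comparison.
  have t4 := hmul (g u)
  rw [mul_assoc, hG, mul_one] at t4
  simp only [Matrix.sub_apply, Matrix.smul_apply, smul_eq_mul, hmul A]
  rw [t1, mul_sub_one ε, sub_mul, show ε * (n : ℝ) * g u j k = ε * ((n : ℝ) * g u j k)
    from mul_assoc _ _ _, t3]
  conv_rhs => enter [2, 2]; rw [t4]
  simp only [Finset.sum_mul, Finset.mul_sum, ← Finset.sum_sub_distrib]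
  exact Finset.sum_congr rfl fun i _ => Finset.sum_congr rfl fun p _ => by ring

/-- The fourth fundamental form in terms of the first and the second. -/
theorem fourthForm_eq (h : LocalHypersurface ε n f ν g U) (hε : ε * ε = 1) (hu : u ∈ U) :
    (Matrix.of fun i j => flatForm ε n (coordDeriv i ν u) (coordDeriv j ν u))
      = secondFormMatrix ε f ν g u * (g u)⁻¹ * secondFormMatrix ε f ν g u
        - (2 * ε * ν u (Fin.last n)) • secondFormMatrix ε f ν g u
        + (ν u (Fin.last n) ^ 2) • g u := by
  have hε0 : ε ≠ 0 := by rintro rfl; simp at hε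
  set A := secondFormMatrix ε f ν g u with hA
  set η := ν u (Fin.last n)
  have hAs : ∀ i j, A i j = A j i := h.secondFormMatrix_symm hε hu
  -- As `⟨ν, ν⟩` is constant, `∂_i ν` has no component along `ν`.
  have hνν : ∀ i, flatForm ε n (coordDeriv i ν u) (ν u) = 0 := by
    intro i
    have h1 := coordDeriv_congr h.isOpen (fun v hv => h.unit v hv) hu i
    rw [coordDeriv_bilin _ (h.smooth_ν u hu).differentiableAt_infty
      (h.smooth_ν u hu).differentiableAt_infty, coordDeriv_const,
      flatForm_comm (ν u)] at h1
    linarith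
  have hνf : ∀ i j, flatForm ε n (coordDeriv i ν u) ((f u (Fin.last n))⁻¹ • coordDeriv j f u)
      = η * g u i j - ε * A i j := by
    intro i j
    rw [hA, secondFormMatrix, Matrix.of_apply, map_smul, smul_eq_mul, ← mul_assoc, mul_neg, hε]
    ring
  -- The left translates `x_{n+1}⁻¹ ∂_j f` have Gram matrix `g` for the flat product and, with `ν`,
  -- form a frame in which the `∂_i ν` are expanded.
  have key : (Matrix.of fun i j => flatForm ε n (coordDeriv i ν u) (coordDeriv j ν u))
      = (η • g u - ε • A) * (g u)⁻¹ * (η • g u - ε • A) := by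
    ext i j
    rw [Matrix.of_apply, bilin_expansion (s := 1) flatForm_comm (by simp)
      (e := fun i => (f u (Fin.last n))⁻¹ • coordDeriv i f u) (ν := ![ν u]) (σ := ![ε]) (g := g u)
      ?_ (h.det_ne_zero u hu)]
    · simp only [hνf, Matrix.mul_apply, Finset.sum_mul, Matrix.sub_apply, Matrix.smul_apply,
        smul_eq_mul, Fin.sum_univ_one, Matrix.cons_val, hνν, mul_zero, add_zero]
      refine Finset.sum_congr rfl fun l _ => Finset.sum_congr rfl fun r _ => ?_
      rw [h.metric_inv_symm hu l r, hAs l j, h.metric_symm hu l j]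
      ring
    · simpa using hε0
    · simp [h.unit u hu]
    · intro i a
      simp [flatForm_comm _ (ν u), h.normal u hu]
    · intro i j
      rw [h.metric u hu]
      simp
      ring
  have hG : (g u)⁻¹ * g u = 1 :=
    Matrix.nonsing_inv_mul _ (isUnit_iff_ne_zero.2 (h.det_ne_zero u hu))
  have hG' : g u * (g u)⁻¹ = 1 :=
    Matrix.mul_nonsing_inv _ (isUnit_iff_ne_zero.2 (h.det_ne_zero u hu))
  rw [key]
  simp only [sub_mul, mul_sub, smul_mul_assoc, mul_smul_comm, hG', one_mul, mul_assoc, hG, mul_one]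
  simp only [smul_sub, smul_smul, hε, one_smul]
  module

end LocalHypersurface
end LightCone

/-! ### Connection and left translations of the half-space. -/

section Ambient

variable {ε : ℝ} {n : ℕ}

theorem flatMetric_mul_self (hε : ε * ε = 1) : flatMetric ε n * flatMetric ε n = 1 := by
  rw [flatMetric, Matrix.diagonal_mul_diagonal, ← Matrix.diagonal_one]
  congr 1
  funext A
  split_ifs <;> simp [hε]

theorem halfSpaceMetric_inv (hε : ε * ε = 1) {y : EuclideanSpace ℝ (Fin (n + 1))}
    (hy : y (Fin.last n) ≠ 0) :
    (halfSpaceMetric ε n y)⁻¹ = (y (Fin.last n) ^ 2) • flatMetric ε n := by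
  apply Matrix.inv_eq_right_inv
  rw [halfSpaceMetric, smul_mul_smul_comm, flatMetric_mul_self hε,
    inv_mul_cancel₀ (pow_ne_zero 2 hy), one_smul]

theorem partialDeriv_halfSpaceMetric {y : EuclideanSpace ℝ (Fin (n + 1))}
    (hy : y (Fin.last n) ≠ 0) (A B C : Fin (n + 1)) :
    partialDeriv A (fun z => halfSpaceMetric ε n z B C) y
      = -2 * (y (Fin.last n) ^ 3)⁻¹ * (if A = Fin.last n then 1 else 0) * flatMetric ε n B C := by
  rw [partialDeriv_eq_coordDeriv]
  have hid : DifferentiableAt ℝ (fun z : EuclideanSpace ℝ (Fin (n + 1)) => z) y :=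
    differentiableAt_id
  have hl : DifferentiableAt ℝ (fun z : EuclideanSpace ℝ (Fin (n + 1)) => z (Fin.last n)) y :=
    (EuclideanSpace.proj (𝕜 := ℝ) (Fin.last n) :
      EuclideanSpace ℝ (Fin (n + 1)) →L[ℝ] ℝ).differentiableAt
  have h1 : (fun z => halfSpaceMetric ε n z B C)
      = fun z => (z (Fin.last n) * z (Fin.last n))⁻¹ * flatMetric ε n B C := by
    funext z
    simp [halfSpaceMetric, sq]
  have h2 : coordDeriv A (fun z : EuclideanSpace ℝ (Fin (n + 1)) => z) y
      = EuclideanSpace.single A 1 := by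
    simp [coordDeriv]
  rw [h1, coordDeriv_mul (F := fun z => (z (Fin.last n) * z (Fin.last n))⁻¹)
      ((hl.mul hl).inv (mul_ne_zero hy hy)) (differentiableAt_const _),
    coordDeriv_const, coordDeriv_inv (c := fun z => z (Fin.last n) * z (Fin.last n))
      (hl.mul hl) (mul_ne_zero hy hy), coordDeriv_mul hl hl,
    coordDeriv_apply hid, h2]
  simp only [PiLp.single_apply, eq_comm (a := Fin.last n)]
  field_simp
  ring

theorem christoffel_halfSpaceMetric (hε : ε * ε = 1) {y : EuclideanSpace ℝ (Fin (n + 1))}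
    (hy : y (Fin.last n) ≠ 0) (A B C : Fin (n + 1)) :
    christoffel (halfSpaceMetric ε n) A B C y = -(y (Fin.last n))⁻¹ * flatMetric ε n A A *
      ((if B = Fin.last n then 1 else 0) * flatMetric ε n C A
        + (if C = Fin.last n then 1 else 0) * flatMetric ε n B A
        - (if A = Fin.last n then 1 else 0) * flatMetric ε n B C) := by
  rw [christoffel, Finset.sum_eq_single A]
  · simp only [partialDeriv_halfSpaceMetric hy, halfSpaceMetric_inv hε hy, Matrix.smul_apply,
      smul_eq_mul]
    field_simp
    ring
  · intro C _ hC
    simp [halfSpaceMetric_inv hε hy, flatMetric, Matrix.diagonal_apply_ne' _ hC]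
  · simp

/-- For a conformally flat metric the connection term consists of two terms along `v` and `w` and
one proportional to `⟨v, w⟩`; orthogonality removes the last. -/
theorem sum_christoffel_halfSpaceMetric (hε : ε * ε = 1) {y : EuclideanSpace ℝ (Fin (n + 1))}
    (hy : y (Fin.last n) ≠ 0) (v w : EuclideanSpace ℝ (Fin (n + 1))) (hvw : flatForm ε n v w = 0)
    (A : Fin (n + 1)) :
    ∑ B, ∑ C, christoffel (halfSpaceMetric ε n) A B C y * v B * w C
      = -(y (Fin.last n))⁻¹ * (v (Fin.last n) * w A + w (Fin.last n) * v A) := by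
  have hAA : flatMetric ε n A A * flatMetric ε n A A = 1 := by
    simp only [flatMetric, Matrix.diagonal_apply_eq]
    split_ifs <;> simp [hε]
  have h1 : ∀ u : EuclideanSpace ℝ (Fin (n + 1)), ∑ C, flatMetric ε n C A * u C
      = flatMetric ε n A A * u A := by
    intro u
    refine Finset.sum_eq_single A (fun C _ hC => ?_) (by simp)
    simp [flatMetric, Matrix.diagonal_apply_ne _ hC]
  have h2 : ∀ u : EuclideanSpace ℝ (Fin (n + 1)),
      ∑ C, (if C = Fin.last n then 1 else 0) * u C = u (Fin.last n) := by
    intro u; simp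
  have h3 : ∑ B, ∑ C, flatMetric ε n B C * v B * w C = 0 := by
    rw [← hvw, ← matrixForm_flatMetric, matrixForm]
  calc _ = -(y (Fin.last n))⁻¹ * flatMetric ε n A A *
      ((∑ B, (if B = Fin.last n then 1 else 0) * v B) * (∑ C, flatMetric ε n C A * w C)
        + (∑ B, flatMetric ε n B A * v B) * (∑ C, (if C = Fin.last n then 1 else 0) * w C)
        - (if A = Fin.last n then 1 else 0) * ∑ B, ∑ C, flatMetric ε n B C * v B * w C) := by
        rw [Finset.sum_mul_sum, Finset.sum_mul_sum]
        simp only [Finset.mul_sum, ← Finset.sum_add_distrib, ← Finset.sum_sub_distrib]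
        refine Finset.sum_congr rfl fun B _ => Finset.sum_congr rfl fun C _ => ?_
        rw [christoffel_halfSpaceMetric hε hy]
        ring
    _ = _ := by
        rw [h1, h1, h2, h2, h3]
        linear_combination (-(y (Fin.last n))⁻¹ * (v (Fin.last n) * w A + w (Fin.last n) * v A))
          * hAA

/-- Left translation by `x⁻¹` is affine, with linear part the homothety of ratio `x_{n+1}⁻¹`. -/
theorem halfSpace_leftTranslate {x : EuclideanSpace ℝ (Fin (n + 1))} (v) :
    fderiv ℝ (fun y => halfSpaceMul (halfSpaceInv x) y) x v = (x (Fin.last n))⁻¹ • v := by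
  have h : (fun y => halfSpaceMul (halfSpaceInv x) y)
      = fun y => (x (Fin.last n))⁻¹ • y + halfSpaceMul (halfSpaceInv x) 0 := by
    funext y
    ext A
    by_cases hA : A = Fin.last n <;> simp [halfSpaceMul, halfSpaceInv, hA]
  rw [h, fderiv_add_const]
  exact DFunLike.congr_fun ((x (Fin.last n))⁻¹ • ContinuousLinearMap.id ℝ
    (EuclideanSpace ℝ (Fin (n + 1)))).fderiv v

theorem matrixForm_single {m : ℕ} (g : Matrix (Fin m) (Fin m) ℝ) (i j : Fin m) :
    matrixForm g (EuclideanSpace.single i 1) (EuclideanSpace.single j 1) = g i j := by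
  simp [matrixForm]

theorem matrixForm_smul {m : ℕ} (c : ℝ) (g : Matrix (Fin m) (Fin m) ℝ)
    (v w : EuclideanSpace ℝ (Fin m)) : matrixForm (c • g) v w = c * matrixForm g v w := by
  simp [matrixForm, Finset.mul_sum, mul_assoc]

theorem matrixForm_sub {m : ℕ} (g k : Matrix (Fin m) (Fin m) ℝ)
    (v w : EuclideanSpace ℝ (Fin m)) :
    matrixForm (g - k) v w = matrixForm g v w - matrixForm k v w := by
  simp [matrixForm, sub_mul]

theorem clm_eq_sum_single {m : ℕ} {V : Type*} [NormedAddCommGroup V] [NormedSpace ℝ V]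
    (L : EuclideanSpace ℝ (Fin m) →L[ℝ] V) (v : EuclideanSpace ℝ (Fin m)) :
    L v = ∑ i, v i • L (EuclideanSpace.single i 1) := by
  conv_lhs => rw [← (EuclideanSpace.basisFun (Fin m) ℝ).sum_repr v]
  simp

theorem bilin_clm_eq_matrixForm {m : ℕ} {V W : Type*} [NormedAddCommGroup V] [NormedSpace ℝ V]
    [NormedAddCommGroup W] [NormedSpace ℝ W]
    (B : V →L[ℝ] W →L[ℝ] ℝ) (L : EuclideanSpace ℝ (Fin m) →L[ℝ] V)
    (K : EuclideanSpace ℝ (Fin m) →L[ℝ] W) (v w : EuclideanSpace ℝ (Fin m)) :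
    B (L v) (K w) = matrixForm (Matrix.of fun i j =>
      B (L (EuclideanSpace.single i 1)) (K (EuclideanSpace.single j 1))) v w := by
  rw [clm_eq_sum_single L v, clm_eq_sum_single K w]
  simp only [map_sum, map_smul, FunLike.coe_sum, Finset.sum_apply, FunLike.coe_smul,
    Pi.smul_apply, smul_eq_mul, matrixForm, Matrix.of_apply, Finset.mul_sum]
  rw [Finset.sum_comm]
  exact Finset.sum_congr rfl fun i _ => Finset.sum_congr rfl fun j _ => by ring

end Ambient

/-! ### From the manifold to the preferred chart, and the pointwise theorem. -/

namespace HalfSpaceHypersurface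

variable {ε : ℝ} {n : ℕ} {M : Type*} [TopologicalSpace M]
  [ChartedSpace (EuclideanSpace ℝ (Fin n)) M]

theorem normalGaussMap_eq (S : HalfSpaceHypersurface ε n M) (p : M) :
    S.normalGaussMap p = (S.x p (Fin.last n))⁻¹ • S.N p :=
  halfSpace_leftTranslate _

theorem mfderiv_eq_fderiv_chart {k : ℕ} {F : M → EuclideanSpace ℝ (Fin k)} {p : M}
    (hF : MDifferentiableAt (𝓡 n) 𝓘(ℝ, EuclideanSpace ℝ (Fin k)) F p)
    (v : EuclideanSpace ℝ (Fin n)) :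
    mfderiv (𝓡 n) 𝓘(ℝ, EuclideanSpace ℝ (Fin k)) F p v
      = fderiv ℝ (F ∘ (extChartAt (𝓡 n) p).symm) (extChartAt (𝓡 n) p p) v := by
  rw [hF.mfderiv, ModelWithCorners.range_eq_univ, fderivWithin_univ]
  rfl

theorem contMDiff_normalGaussMap (S : HalfSpaceHypersurface ε n M) :
    ContMDiff (𝓡 n) 𝓘(ℝ, EuclideanSpace ℝ (Fin (n + 1))) ∞ S.normalGaussMap := by
  have h1 : S.normalGaussMap = fun p => (S.x p (Fin.last n))⁻¹ • S.N p :=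
    funext S.normalGaussMap_eq
  rw [h1]
  have h2 : ContMDiff (𝓡 n) 𝓘(ℝ, ℝ) ∞ fun p => S.x p (Fin.last n) :=
    (EuclideanSpace.proj (𝕜 := ℝ) (Fin.last n) :
      EuclideanSpace ℝ (Fin (n + 1)) →L[ℝ] ℝ).contDiff.contMDiff.comp S.contMDiff_x
  exact (h2.inv₀ fun p => (S.x_last_pos p).ne').smul S.contMDiff_N

theorem flatForm_normal (S : HalfSpaceHypersurface ε n M) (p : M) (v : TangentSpace (𝓡 n) p) :
    flatForm ε n (S.N p) (S.dx p v) = 0 := by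
  have h := (matrixForm_halfSpaceMetric _ _ _).symm.trans (S.normal p v)
  exact (mul_eq_zero.1 h).resolve_left (inv_ne_zero (pow_ne_zero 2 (S.x_last_pos p).ne'))

/-- The immersion in the preferred chart at `p`. -/
def chartX (S : HalfSpaceHypersurface ε n M) (p : M) :
    EuclideanSpace ℝ (Fin n) → EuclideanSpace ℝ (Fin (n + 1)) :=
  S.x ∘ (extChartAt (𝓡 n) p).symm

/-- The normal Gauss map in the preferred chart at `p`. -/
def chartNormal (S : HalfSpaceHypersurface ε n M) (p : M) :
    EuclideanSpace ℝ (Fin n) → EuclideanSpace ℝ (Fin (n + 1)) :=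
  S.normalGaussMap ∘ (extChartAt (𝓡 n) p).symm

theorem chartX_center (S : HalfSpaceHypersurface ε n M) (p : M) :
    S.chartX p (extChartAt (𝓡 n) p p) = S.x p := by
  simp [chartX]

theorem chartNormal_center (S : HalfSpaceHypersurface ε n M) (p : M) :
    S.chartNormal p (extChartAt (𝓡 n) p p) = S.normalGaussMap p := by
  simp [chartNormal]

theorem dx_eq (S : HalfSpaceHypersurface ε n M) (p : M) (v : EuclideanSpace ℝ (Fin n)) :
    S.dx p v = fderiv ℝ (S.chartX p) (extChartAt (𝓡 n) p p) v :=
  mfderiv_eq_fderiv_chart (S.contMDiff_x.contMDiffAt.mdifferentiableAt (by simp)) v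

theorem dN_eq (S : HalfSpaceHypersurface ε n M) (p : M) (v : EuclideanSpace ℝ (Fin n)) :
    S.dN p v = fderiv ℝ (S.N ∘ (extChartAt (𝓡 n) p).symm) (extChartAt (𝓡 n) p p) v :=
  mfderiv_eq_fderiv_chart (S.contMDiff_N.contMDiffAt.mdifferentiableAt (by simp)) v

theorem secondForm_eq_flatForm (S : HalfSpaceHypersurface ε n M) (hε : ε * ε = 1) (p : M)
    (v w : EuclideanSpace ℝ (Fin n)) :
    S.secondForm p v w = -ε * ((S.x p (Fin.last n) ^ 2)⁻¹ * (flatForm ε n (S.dN p v) (S.dx p w)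
      - (S.x p (Fin.last n))⁻¹ * S.N p (Fin.last n) * flatForm ε n (S.dx p v) (S.dx p w))) := by
  have h0 := (S.x_last_pos p).ne'
  -- The term along `N` disappears below on pairing with `dx w`.
  have h1 : S.covDerivNormal p v = S.dN p v - (S.x p (Fin.last n))⁻¹ •
      (S.dx p v (Fin.last n) • S.N p + S.N p (Fin.last n) • S.dx p v) := by
    ext A
    simp only [covDerivNormal]
    rw [sum_christoffel_halfSpaceMetric hε h0 _ _
      ((flatForm_comm _ _).trans (S.flatForm_normal p v))]
    simp
    ring
  refine (congrArg (-ε * ·) (matrixForm_halfSpaceMetric _ _ _)).trans ?_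
  rw [h1]
  simp only [map_sub, map_smul, map_add, sub_apply, smul_apply, add_apply, S.flatForm_normal p w,
    smul_eq_mul]
  ring

theorem fourthForm_single (S : HalfSpaceHypersurface ε n M) (p : M) (i j : Fin n) :
    S.fourthForm p (EuclideanSpace.single i (1 : ℝ) : EuclideanSpace ℝ (Fin n))
      (EuclideanSpace.single j (1 : ℝ) : EuclideanSpace ℝ (Fin n))
      = flatForm ε n (coordDeriv i (S.chartNormal p) (extChartAt (𝓡 n) p p))
        (coordDeriv j (S.chartNormal p) (extChartAt (𝓡 n) p p)) := by
  have h := fun v : EuclideanSpace ℝ (Fin n) => mfderiv_eq_fderiv_chart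
    (S.contMDiff_normalGaussMap.contMDiffAt.mdifferentiableAt (x := p) (by simp)) v
  refine (matrixForm_flatMetric _ _).trans ?_
  exact congrArg₂ (fun a b => flatForm ε n a b) (h _) (h _)

variable [IsManifold (𝓡 n) ∞ M]

theorem contDiffAt_chart {k : ℕ} {F : M → EuclideanSpace ℝ (Fin k)}
    (hF : ContMDiff (𝓡 n) 𝓘(ℝ, EuclideanSpace ℝ (Fin k)) ∞ F) (p : M)
    {u : EuclideanSpace ℝ (Fin n)} (hu : u ∈ (extChartAt (𝓡 n) p).target) :
    ContDiffAt ℝ ∞ (F ∘ (extChartAt (𝓡 n) p).symm) u := by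
  have h := hF.comp_contMDiffOn (contMDiffOn_extChartAt_symm (I := 𝓡 n) (n := ∞) p)
  rw [contMDiffOn_iff_contDiffOn] at h
  exact h.contDiffAt ((isOpen_extChartAt_target p).mem_nhds hu)

theorem fderiv_chart {k : ℕ} {F : M → EuclideanSpace ℝ (Fin k)}
    (hF : ContMDiff (𝓡 n) 𝓘(ℝ, EuclideanSpace ℝ (Fin k)) ∞ F) (p : M)
    {u : EuclideanSpace ℝ (Fin n)} (hu : u ∈ (extChartAt (𝓡 n) p).target)
    (v : EuclideanSpace ℝ (Fin n)) :
    fderiv ℝ (F ∘ (extChartAt (𝓡 n) p).symm) u v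
      = mfderiv (𝓡 n) 𝓘(ℝ, EuclideanSpace ℝ (Fin k)) F ((extChartAt (𝓡 n) p).symm u)
        (mfderiv 𝓘(ℝ, EuclideanSpace ℝ (Fin n)) (𝓡 n) (extChartAt (𝓡 n) p).symm u v) := by
  have h1 : MDifferentiableAt 𝓘(ℝ, EuclideanSpace ℝ (Fin n)) (𝓡 n)
      (extChartAt (𝓡 n) p).symm u :=
    ((contMDiffOn_extChartAt_symm (I := 𝓡 n) (n := ∞) p).contMDiffAt
      ((isOpen_extChartAt_target p).mem_nhds hu)).mdifferentiableAt (by simp)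
  rw [← mfderiv_eq_fderiv, mfderiv_comp u (hF.contMDiffAt.mdifferentiableAt (by simp)) h1]
  rfl

/-- Curvature involves derivatives of the metric, so positivity is needed on the whole chart target
and not only at its centre; this transports tangent vectors there. -/
theorem mfderiv_chart_symm_ne_zero (p : M)
    {u : EuclideanSpace ℝ (Fin n)} (hu : u ∈ (extChartAt (𝓡 n) p).target)
    {v : EuclideanSpace ℝ (Fin n)} (hv : v ≠ 0) :
    mfderiv 𝓘(ℝ, EuclideanSpace ℝ (Fin n)) (𝓡 n) (extChartAt (𝓡 n) p).symm u v ≠ 0 := by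
  intro h0
  apply hv
  have h := mfderiv_extChartAt_comp_mfderivWithin_extChartAt_symm (I := 𝓡 n) hu
  rw [ModelWithCorners.range_eq_univ, mfderivWithin_univ] at h
  have h2 := DFunLike.congr_fun h v
  exact h2.symm.trans ((congrArg _ h0).trans
    (mfderiv (𝓡 n) 𝓘(ℝ, EuclideanSpace ℝ (Fin n)) (extChartAt (𝓡 n) p) _).map_zero)

theorem metricInChart_pos (S : HalfSpaceHypersurface ε n M) (p : M)
    {u : EuclideanSpace ℝ (Fin n)} (hu : u ∈ (extChartAt (𝓡 n) p).target)
    {v : EuclideanSpace ℝ (Fin n)} (hv : v ≠ 0) : 0 < matrixForm (S.metricInChart p u) v v := by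
  have h1 := S.induced_pos _ _ (mfderiv_chart_symm_ne_zero p hu hv)
  rw [← fderiv_chart S.contMDiff_x p hu, matrixForm_halfSpaceMetric,
    bilin_clm_eq_matrixForm, ← matrixForm_smul] at h1
  convert h1 using 2
  ext i j
  simp [metricInChart, matrixForm_halfSpaceMetric]

theorem metricInChart_posDef (S : HalfSpaceHypersurface ε n M) (p : M)
    {u : EuclideanSpace ℝ (Fin n)} (hu : u ∈ (extChartAt (𝓡 n) p).target) :
    (S.metricInChart p u).PosDef := by
  refine Matrix.PosDef.of_dotProduct_mulVec_pos ?_ fun v hv => ?_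
  · ext i j
    rw [Matrix.conjTranspose_apply, star_trivial]
    simp only [metricInChart, Matrix.of_apply, matrixForm_halfSpaceMetric]
    rw [flatForm_comm]
  · have h1 := S.metricInChart_pos p hu (v := WithLp.toLp 2 v) (by simpa using hv)
    refine h1.trans_eq ?_
    simp only [matrixForm, dotProduct, Matrix.mulVec, Finset.mul_sum, star_trivial]
    exact Finset.sum_congr rfl fun i _ => Finset.sum_congr rfl fun j _ => by ring

theorem localHypersurface (S : HalfSpaceHypersurface ε n M) (p : M) :
    LocalHypersurface ε n (S.chartX p) (S.chartNormal p) (S.metricInChart p)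
      (extChartAt (𝓡 n) p).target where
  isOpen := isOpen_extChartAt_target p
  smooth_f u hu := contDiffAt_chart S.contMDiff_x p hu
  smooth_ν u hu := contDiffAt_chart S.contMDiff_normalGaussMap p hu
  pos u hu := S.x_last_pos _
  unit u hu := by
    have h := S.unit ((extChartAt (𝓡 n) p).symm u)
    rw [matrixForm_halfSpaceMetric] at h
    rw [chartNormal, Function.comp_apply, normalGaussMap_eq]
    refine Eq.trans ?_ h
    simp
    ring
  normal u hu i := by
    have h : flatForm ε n (S.N ((extChartAt (𝓡 n) p).symm u))
        (coordDeriv i (S.chartX p) u) = 0 := by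
      rw [coordDeriv, chartX, fderiv_chart S.contMDiff_x p hu]
      exact S.flatForm_normal _ _
    rw [chartNormal, Function.comp_apply, normalGaussMap_eq, map_smul, smul_apply, h, smul_zero]
  metric u hu i j := by
    simp only [metricInChart, Matrix.of_apply, matrixForm_halfSpaceMetric]
    rfl
  det_ne_zero u hu := (S.metricInChart_posDef p hu).det_pos.ne'

theorem metricInChart_center (S : HalfSpaceHypersurface ε n M) (p : M) (i j : Fin n) :
    S.metricInChart p (extChartAt (𝓡 n) p p) i j = (S.x p (Fin.last n) ^ 2)⁻¹ *
      flatForm ε n (coordDeriv i (S.chartX p) (extChartAt (𝓡 n) p p))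
        (coordDeriv j (S.chartX p) (extChartAt (𝓡 n) p p)) := by
  rw [(S.localHypersurface p).metric _ (mem_extChartAt_target p), chartX_center]

theorem firstForm_eq (S : HalfSpaceHypersurface ε n M) (p : M) (v w : EuclideanSpace ℝ (Fin n)) :
    S.firstForm p v w = matrixForm (S.metricInChart p (extChartAt (𝓡 n) p p)) v w := by
  refine (matrixForm_halfSpaceMetric _ _ _).trans ?_
  rw [dx_eq, dx_eq, bilin_clm_eq_matrixForm,
    ← matrixForm_smul]
  congr 1
  ext i j
  rw [metricInChart_center]
  rfl

/-- Differentiating the factor in `x_{n+1}⁻¹ N` only produces a multiple of `N`, which is orthogonal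
to `∂_j x`. -/
theorem flatForm_coordDeriv_chartNormal (S : HalfSpaceHypersurface ε n M) (p : M) (i j : Fin n) :
    flatForm ε n (coordDeriv i (S.chartNormal p) (extChartAt (𝓡 n) p p))
        (coordDeriv j (S.chartX p) (extChartAt (𝓡 n) p p))
      = (S.x p (Fin.last n))⁻¹ * flatForm ε n
        (fderiv ℝ (S.N ∘ (extChartAt (𝓡 n) p).symm) (extChartAt (𝓡 n) p p)
          (EuclideanSpace.single i 1))
        (fderiv ℝ (S.chartX p) (extChartAt (𝓡 n) p p) (EuclideanSpace.single j 1)) := by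
  set u := extChartAt (𝓡 n) p p with hu
  have hut := mem_extChartAt_target (I := 𝓡 n) p
  have h0 := (S.x_last_pos p).ne'
  have h1 : S.chartNormal p = fun y => (S.chartX p y (Fin.last n))⁻¹ •
      (S.N ∘ (extChartAt (𝓡 n) p).symm) y := by
    funext y
    exact S.normalGaussMap_eq _
  have hx : ContDiffAt ℝ ∞ (fun y => S.chartX p y (Fin.last n)) u :=
    LocalHypersurface.smooth_last (contDiffAt_chart S.contMDiff_x p hut) _
  have hx0 : S.chartX p u (Fin.last n) ≠ 0 := by rw [hu, chartX_center]; exact h0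
  have h2 : flatForm ε n ((S.N ∘ (extChartAt (𝓡 n) p).symm) u)
      (coordDeriv j (S.chartX p) u) = 0 := by
    have h3 := S.flatForm_normal p (EuclideanSpace.single j (1 : ℝ) : EuclideanSpace ℝ (Fin n))
    rw [hu, Function.comp_apply, extChartAt_to_inv]
    rw [dx_eq] at h3
    exact h3
  rw [h1, coordDeriv_smul (c := fun y => (S.chartX p y (Fin.last n))⁻¹)
    (hx.inv hx0).differentiableAt_infty
    (contDiffAt_chart S.contMDiff_N p hut).differentiableAt_infty, map_add, map_smul, map_smul,
    add_apply, smul_apply, smul_apply, h2, smul_zero, zero_add, smul_eq_mul, hu, chartX_center]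
  rfl

/-- The matrix of the second fundamental form at `p`. -/
def secondMatrix (S : HalfSpaceHypersurface ε n M) (p : M) : Matrix (Fin n) (Fin n) ℝ :=
  secondFormMatrix ε (S.chartX p) (S.chartNormal p) (S.metricInChart p) (extChartAt (𝓡 n) p p)

theorem secondForm_eq (S : HalfSpaceHypersurface ε n M) (hε : ε * ε = 1) (p : M)
    (v w : EuclideanSpace ℝ (Fin n)) : S.secondForm p v w = matrixForm (S.secondMatrix p) v w := by
  rw [secondForm_eq_flatForm S hε, dx_eq, dx_eq, dN_eq, bilin_clm_eq_matrixForm,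
    bilin_clm_eq_matrixForm, ← matrixForm_smul, ← matrixForm_sub, ← matrixForm_smul,
    ← matrixForm_smul]
  congr 1
  ext i j
  simp only [secondMatrix, secondFormMatrix, Matrix.smul_apply, Matrix.sub_apply, Matrix.of_apply,
    metricInChart_center, flatForm_coordDeriv_chartNormal, chartX_center, chartNormal_center,
    normalGaussMap_eq, smul_eq_mul, PiLp.smul_apply]
  simp only [coordDeriv]
  ring

theorem meanCurvature_eq (S : HalfSpaceHypersurface ε n M) (hε : ε * ε = 1) (p : M) :
    S.meanCurvature p = (1 / n) *
      ((S.metricInChart p (extChartAt (𝓡 n) p p))⁻¹ * S.secondMatrix p).trace := by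
  have h1 : (Matrix.of fun i j : Fin n => S.firstForm p (EuclideanSpace.single i (1 : ℝ) :
      EuclideanSpace ℝ (Fin n)) (EuclideanSpace.single j (1 : ℝ) : EuclideanSpace ℝ (Fin n)))
      = S.metricInChart p (extChartAt (𝓡 n) p p) := by
    ext i j
    exact (S.firstForm_eq p _ _).trans (matrixForm_single _ i j)
  have h2 : (Matrix.of fun i j : Fin n => S.secondForm p (EuclideanSpace.single i (1 : ℝ) :
      EuclideanSpace ℝ (Fin n)) (EuclideanSpace.single j (1 : ℝ) : EuclideanSpace ℝ (Fin n)))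
      = S.secondMatrix p := by
    ext i j
    exact (S.secondForm_eq hε p _ _).trans (matrixForm_single _ i j)
  rw [meanCurvature, h1, h2]

/-- An Einstein hypersurface with non-degenerate second fundamental form, without umbilics and with
conformal normal Gauss map is a surface, and the conformal factor is determined by its mean
curvature and its normal Gauss map. -/
theorem conformal_at (S : HalfSpaceHypersurface ε n M) (hε : ε * ε = 1) {ρ : M → ℝ}
    (hE : S.IsEinstein) (hnd : S.NondegenerateSecondForm) (p : M) (humb : ¬ S.IsUmbilic p)
    (hρ : S.IsConformalNormalGaussMap ρ) :
    n = 2 ∧ ρ p = 2 * (S.meanCurvature p - ε * S.normalGaussMap p (Fin.last n)) := by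
  have hut := mem_extChartAt_target (I := 𝓡 n) p
  have L := S.localHypersurface p
  have hpd := S.metricInChart_posDef p hut
  have hII := S.secondForm_eq hε p
  have hI := S.firstForm_eq p
  have hmean := S.meanCurvature_eq hε p
  have hRic := L.ricciMatrix_eq hε hut
  have hIV := L.fourthForm_eq hε hut
  have hsymm := L.secondFormMatrix_symm hε hut
  rw [chartNormal_center] at hIV
  change ricciMatrix _ _ = ε • (Matrix.trace (_ * S.secondMatrix p) • S.secondMatrix p
    - S.secondMatrix p * _ * S.secondMatrix p) - _ at hRic
  change _ = S.secondMatrix p * _ * S.secondMatrix p - _ • S.secondMatrix p + _ at hIV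
  change ∀ i j, S.secondMatrix p i j = S.secondMatrix p j i at hsymm
  obtain ⟨c, hc⟩ := hE p
  have hRicc : ricciMatrix (S.metricInChart p) (extChartAt (𝓡 n) p p)
      = c • S.metricInChart p (extChartAt (𝓡 n) p p) := by
    ext i j
    have h := hc (EuclideanSpace.single i (1 : ℝ) : EuclideanSpace ℝ (Fin n))
      (EuclideanSpace.single j (1 : ℝ) : EuclideanSpace ℝ (Fin n))
    rw [hI] at h
    exact ((matrixForm_single _ i j).symm.trans h).trans
      (congrArg (c * ·) (matrixForm_single _ i j))
  have hconf : (Matrix.of fun i j =>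
      flatForm ε n (coordDeriv i (S.chartNormal p) (extChartAt (𝓡 n) p p))
        (coordDeriv j (S.chartNormal p) (extChartAt (𝓡 n) p p))) = ρ p • S.secondMatrix p := by
    ext i j
    have h := hρ p (EuclideanSpace.single i (1 : ℝ) : EuclideanSpace ℝ (Fin n))
      (EuclideanSpace.single j (1 : ℝ) : EuclideanSpace ℝ (Fin n))
    rw [hII, fourthForm_single] at h
    exact h.trans (congrArg (ρ p * ·) (matrixForm_single _ i j))
  have hscal : ∀ a : ℝ, S.secondMatrix p ≠ a • S.metricInChart p (extChartAt (𝓡 n) p p) := by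
    intro a ha
    refine humb ⟨a, fun v w => ?_⟩
    exact (hII v w).trans ((congrArg (matrixForm · v w) ha).trans
      ((matrixForm_smul _ _ _ _).trans (congrArg (a * ·) (hI v w).symm)))
  have hdet : (S.secondMatrix p).det ≠ 0 := by
    intro h0
    obtain ⟨v, hv, hv0⟩ := Matrix.exists_vecMul_eq_zero_iff.2 h0
    apply hv
    have h1 := hnd p (WithLp.toLp 2 v : EuclideanSpace ℝ (Fin n)) fun w => by
      refine (hII _ w).trans ?_
      refine Finset.sum_comm.trans ?_
      refine Finset.sum_eq_zero fun j _ => ?_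
      have h2 := congrFun hv0 j
      simp only [Matrix.vecMul, dotProduct, Pi.zero_apply] at h2
      rw [← Finset.sum_mul, mul_eq_zero]
      left
      rw [← h2]
      exact Finset.sum_congr rfl fun i _ => mul_comm _ _
    exact (WithLp.toLp_eq_zero 2).1 h1
  rw [hconf] at hIV
  rw [hRicc] at hRic
  set G := S.metricInChart p (extChartAt (𝓡 n) p p)
  set A := S.secondMatrix p
  set η := S.normalGaussMap p (Fin.last n)
  -- `σ` collects the two multiples of `II` in `IV = ρ II`. The constant is the Einstein factor plus
  -- `ε (n - 1)`, multiplied by `ε = ε⁻¹` to solve the Gauss equation for `tr S · II - III`.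
  obtain ⟨hn, hσ⟩ := dim_eq_two_of_quadratic (σ := ρ p + 2 * ε * η) (η := η)
    (c := ε * (c + ε * (n - 1))) hpd (by ext i j; exact hsymm j i) hdet hscal
    (by rw [add_smul, hIV]; abel)
    (by
      have h1 := congrArg (fun Z => ε • (Z + (ε * (n - 1 : ℝ)) • G)) hRic
      simp only [sub_add_cancel, smul_smul, hε, one_smul, ← add_smul] at h1
      exact h1.symm)
  refine ⟨hn, ?_⟩
  have hn' : (n : ℝ) = 2 := by exact_mod_cast hn
  -- With `n = 2` the mean curvature is half of `tr S = ρ + 2 ε η`.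
  rw [hmean, ← hσ, hn']
  ring

end HalfSpaceHypersurface

end

theorem theorem3p4 (n : ℕ) (M : Type*) [TopologicalSpace M]
    [ChartedSpace (EuclideanSpace ℝ (Fin n)) M] [IsManifold (𝓡 n) ∞ M] [Nonempty M] :
    (∀ (S : HalfSpaceHypersurface 1 n M) (ρ : M → ℝ),
      S.IsEinstein → S.NondegenerateSecondForm → (∀ p : M, ¬ S.IsUmbilic p) →
      S.IsConformalNormalGaussMap ρ →
        n = 2 ∧ ∀ p : M, ρ p = 2 * (S.meanCurvature p - S.normalGaussMap p (Fin.last n))) ∧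
    (∀ (S : HalfSpaceHypersurface (-1) n M) (ρ : M → ℝ),
      S.IsEinstein → S.NondegenerateSecondForm → (∀ p : M, ¬ S.IsUmbilic p) →
      S.IsConformalNormalGaussMap ρ →
        n = 2 ∧ ∀ p : M, ρ p = 2 * (S.meanCurvature p + S.normalGaussMap p (Fin.last n))) := by
  obtain ⟨p₀⟩ := ‹Nonempty M›
  refine ⟨fun S ρ hE hnd humb hρ => ⟨?_, fun p => ?_⟩, fun S ρ hE hnd humb hρ => ⟨?_, fun p => ?_⟩⟩
  · exact (S.conformal_at (by norm_num) hE hnd p₀ (humb p₀) hρ).1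
  · rw [(S.conformal_at (by norm_num) hE hnd p (humb p) hρ).2, one_mul]
  · exact (S.conformal_at (by norm_num) hE hnd p₀ (humb p₀) hρ).1
  · rw [(S.conformal_at (by norm_num) hE hnd p (humb p) hρ).2, neg_one_mul, sub_neg_eq_add]
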